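/- **Setting.** Let ${\mathcal X}\subseteq\mathbb R^{d}$ be a Borel set and let the horizon be $M\in\{1,2,\dots\}\cup\{\infty\}$; $n$ always ranges over integers $\le M$. A state space model ${\sf S}=(\pi_0,K,g)$ consists of a probability measure $\pi_0$ on ${\mathcal X}$, Markov kernels $K_n$ on ${\mathcal X}$ and measurable likelihoods $g_n:{\mathcal X}\to\mathbb R$, $n\ge 1$. Put $\mu(f)=\int f\,d\mu$, $K_n\mu(dz)=\int K_n(x,dz)\,\mu(dx)$, $$\Phi_n(\mu)(f)=\frac{K_n\mu(fg_n)}{K_n\mu(g_n)},\qquad \Phi_{m:n}=\Phi_n\circ\cdots\circ\Phi_{m+1}\ \ (\Phi_{n:n}=\mathrm{id}),$$ and let $\pi_n=\Phi_n(\pi_{n-1})$, $n\ge1$, be the optimal filter. Test functions $f:{\mathcal X}\to\mathbb R$ are measurable, and $\|\mu-\eta\|_{TV}=\sup_{|f|\le1}\frac12|\mu(f)-\eta(f)|$. The *bootstrap particle filter* with $N$ particles run on ${\sf S}$ draws $x_0^1,\dots,x_0^N$ i.i.d. from $\pi_0$ and, for $n\ge1$, draws $\bar x_n^i\sim K_n(x_{n-1}^i,\cdot)$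 independently for $i=1,\dots,N$, sets $w_n^i=g_n(\bar x_n^i)/\sum_j g_n(\bar x_n^j)$, and draws $x_n^1,\dots,x_n^N$ i.i.d. from $\sum_j w_n^j\delta_{\bar x_n^j}$; its output at time $n$ is $\frac1N\sum_i\delta_{x_n^i}$. For compact sets ${\mathcal C}_n^l\subseteq{\mathcal X}$, $n\ge0$, $l\ge1$, let $\hat{\sf S}^l=(\hat\pi_0^l,\hat K^l,g)$ be the constrained model in which $\hat\pi_0^l$ is $\pi_0$ conditioned on ${\mathcal C}_0^l$ and $\hat K_n^l(x',\cdot)$ is $K_n(x',\cdot)$ conditioned on ${\mathcal C}_n^l$. Let $\hat\pi_n^l$ be its optimal filter, and $\hat\pi_n^{l,N}$ the output of the bootstrap particle filter run on $\hat{\sf S}^l$. Write $\|Z\|_p=\mathbb E[|Z|^p]^{1/p}$. **Theorem.** Assume: 1. $K_n(x',dx)=k_n(x',x)\,dx$ with $k_n:{\mathcal X}\times{\mathcal X}\to(0,\infty)$ and $\|k\|_\infty:=\sup_{n\ge1,x',x}k_n(x',x)<\infty$; $g_n>0$ for $n\ge1$ and $\|g\|_\infty:=\sup_{n\ge1,x}g_n(x)<\infty$.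 2. There is a non-increasing sequence $(r_i)_{i\ge0}$ with $r_0=1$ and $\sum_i r_i<\infty$ such that $\|\Phi_{m:n}(\mu)-\Phi_{m:n}(\eta)\|_{TV}\le r_{n-m}\|\mu-\eta\|_{TV}$ for all $0\le m\le n$ and all probability measures $\mu,\eta$ on ${\mathcal X}$. 3. There is $\zeta>0$ with $g_n(x)>\zeta$ for all $n\ge1$ and $x\in{\mathcal X}$. 4. For every $n\ge0$, $\lim_{l\to\infty}{\mathcal C}^l_n={\mathcal X}$ (every point of ${\mathcal X}$ lies in ${\mathcal C}^l_n$ for all large $l$), and there is a non-decreasing sequence $\varepsilon^l>0$ with $\lim_{l\to\infty}\varepsilon^l=1$, $\pi_0({\mathcal C}_0^l)\ge\varepsilon^l$, and $K_n(x',{\mathcal C}_n^l)\ge\varepsilon^l$ for all $n\ge1$ and $x'\in{\mathcal C}_{n-1}^l$. 5. For every $l$ there is $\bar\gamma_l>0$ with $k_n(x',x)\ge\bar\gamma_l$ for all $n\ge1$, $x'\in{\mathcal C}_{n-1}^l$, $x\in{\mathcal C}_n^l$. Put $\gamma_l:=\bar\gamma_l^2/\|k\|_\infty^2$. Then there is a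 finite constant $c$, independent of $n$, $l$, $N$ and $p$, with $\sup_{|f|\le1}|\pi_n(f)-\hat\pi_n^l(f)|\le c\,\frac{1-\varepsilon^l}{\varepsilon^l}$ for all $n\ge0$ and $l\ge1$, such that for every real $p\ge1$, with a finite constant $c_p$ that depends only on $p$, the following hold. (i) For all $l,N\ge1$, $$\sup_{n\ge1,\,|f|\le1}\|\pi_n(f)-\hat\pi_n^{l,N}(f)\|_p<c\,\frac{1-\varepsilon^l}{\varepsilon^l}+\frac{c_p\|g\|_\infty}{\zeta\gamma_l^3\sqrt N}.$$ (ii) For every $l$ the following limit exists and $$\lim_{N\to\infty}\ \sup_{n\ge1,\,|f|\le1}\|\pi_n(f)-\hat\pi_n^{l,N}(f)\|_p\le c\,\frac{1-\varepsilon^l}{\varepsilon^l},$$ with strict inequality whenever $\varepsilon^l<1$. (iii) There is a finite constant $\bar c$, independent of $N$ and $n$, such that for every $N\ge1$ the following limits exist and $$\sup_{n\ge0,\,|f|\le1}\ \lim_{l\to\infty}\|\pi_n(f)-\hat\pi_n^{l,N}(f)\|_p<\frac{\bar c}{\sqrt N}.$$ -/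

import Mathlib

open MeasureTheory ProbabilityTheory Filter Topology
open scoped ENNReal

noncomputable section

/-- The observation times `1 ≤ n ≤ M`, where the horizon `M` may be infinite. -/
def obsTimes (M : ℕ∞) : Set ℕ := {n | 1 ≤ n ∧ (n : ℕ∞) ≤ M}

/-- A test function: measurable, with `|f| ≤ 1`. -/
def IsTest {E : Type*} [MeasurableSpace E] (f : E → ℝ) : Prop :=
  Measurable f ∧ ∀ x, |f x| ≤ 1

/-- Total variation distance of probability measures,
`sup_{|f| ≤ 1} |μ(f) - η(f)| / 2`. -/
def tvDist {E : Type*} [MeasurableSpace E] (μ η : Measure E) : ℝ :=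
  ⨆ f : {f : E → ℝ // IsTest f}, (1 / 2 : ℝ) * |∫ x, f.1 x ∂μ - ∫ x, f.1 x ∂η|

/-- The data `(π₀, K, g)` of a state space model on `E`: the prior, the kernels `K_n` and the
likelihoods `g_n`, `n ≥ 1` (the entries with index `0` are never used). -/
structure SSM (E : Type*) [MeasurableSpace E] where
  init : Measure E
  kernel : ℕ → Kernel E E
  lik : ℕ → E → ℝ

/-- The kernel `x' ↦ K(x', · ∩ C) / K(x', C)`. -/
def condKernel {E : Type*} [MeasurableSpace E] (κ : Kernel E E) (C : Set E)
    (hC : MeasurableSet C) : Kernel E E where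
  toFun x := ProbabilityTheory.cond (κ x) C
  measurable' := by
    refine Measure.measurable_of_measurable_coe _ fun s hs => ?_
    simp only [ProbabilityTheory.cond_apply hC]
    exact ((κ.measurable_coe hC).inv).mul (κ.measurable_coe (hC.inter hs))

/-- One step of mutation: given `x`, the new particles are independent, the `i`-th one with
law `κ (x i)`. -/
def mutate {E : Type*} [MeasurableSpace E] (κ : Kernel E E) {N : ℕ} (x : Fin N → E) :
    Measure (Fin N → E) :=
  Measure.pi fun i => κ (x i)

/-- The weighted empirical measure `∑ⱼ wⱼ δ_{xⱼ}` with `wⱼ = g (xⱼ) / ∑ᵢ g (xᵢ)`. -/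
def weighted {E : Type*} [MeasurableSpace E] (g : E → ℝ) {N : ℕ} (x : Fin N → E) : Measure E :=
  ∑ j, ENNReal.ofReal (g (x j) / ∑ i, g (x i)) • Measure.dirac (x j)

/-- Resampling: `N` i.i.d. draws from the weighted empirical measure. -/
def resample {E : Type*} [MeasurableSpace E] (g : E → ℝ) {N : ℕ} (x : Fin N → E) :
    Measure (Fin N → E) :=
  Measure.pi fun _ => weighted g x

/-- The empirical measure `N⁻¹ ∑ᵢ δ_{xᵢ}`. -/
def empirical {E : Type*} [MeasurableSpace E] {N : ℕ} (x : Fin N → E) : Measure E :=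
  (N : ℝ≥0∞)⁻¹ • ∑ i, Measure.dirac (x i)

namespace SSM

/-- `S` is a Markov state space model up to the horizon `M`. -/
structure IsMarkov {E : Type*} [MeasurableSpace E] (S : SSM E) (M : ℕ∞) : Prop where
  init : IsProbabilityMeasure S.init
  kernel : ∀ n ∈ obsTimes M, IsMarkovKernel (S.kernel n)
  lik : ∀ n ∈ obsTimes M, Measurable (S.lik n)

/-- The prediction-update operator `Φ_n(μ)(f) = (K_n μ)(f g_n) / (K_n μ)(g_n)`. -/
def pu {E : Type*} [MeasurableSpace E] (S : SSM E) (n : ℕ) (μ : Measure E) : Measure E :=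
  let ν := (μ.bind (S.kernel n)).withDensity fun x => ENNReal.ofReal (S.lik n x)
  (ν Set.univ)⁻¹ • ν

/-- The composition `Φ_{m:m+j} = Φ_{m+j} ∘ ⋯ ∘ Φ_{m+1}`. -/
def puIter {E : Type*} [MeasurableSpace E] (S : SSM E) (m : ℕ) : ℕ → Measure E → Measure E
  | 0, μ => μ
  | j + 1, μ => S.pu (m + j + 1) (S.puIter m j μ)

/-- The optimal filter: `π_0` is the prior and `π_n = Φ_n(π_{n-1})`. -/
def filter {E : Type*} [MeasurableSpace E] (S : SSM E) : ℕ → Measure E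
  | 0 => S.init
  | n + 1 => S.pu (n + 1) (S.filter n)

/-- The joint law of the resampled particles `(x_n^1, …, x_n^N)` of the bootstrap particle
filter with `N` particles, run on the model `S`. -/
def particleLaw {E : Type*} [MeasurableSpace E] (S : SSM E) (N : ℕ) : ℕ → Measure (Fin N → E)
  | 0 => Measure.pi fun _ => S.init
  | n + 1 => ((S.particleLaw N n).bind (mutate (S.kernel (n + 1)))).bind
      (resample (S.lik (n + 1)))

/-- The constrained model: the prior conditioned on `C 0`, and the kernels `K_n(x', ·)`
conditioned on `C n`. -/
def constrain {E : Type*} [MeasurableSpace E] [TopologicalSpace E] [T2Space E]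
    [OpensMeasurableSpace E] (S : SSM E) (C : ℕ → TopologicalSpace.Compacts E) : SSM E where
  init := ProbabilityTheory.cond S.init (C 0 : Set E)
  kernel n := condKernel (S.kernel n) (C n : Set E) (C n).isCompact.measurableSet
  lik := S.lik

/-- The `L^p` norm of `π(f) - π_n^N(f)`, where `π_n^N` is the empirical measure of the particle
filter run on `S`. -/
def pfError {E : Type*} [MeasurableSpace E] (S : SSM E) (π : Measure E) (N n : ℕ) (p : ℝ)
    (f : E → ℝ) : ℝ≥0∞ :=
  eLpNorm (fun x : Fin N → E => ∫ y, f y ∂π - ∫ y, f y ∂(empirical x)) (ENNReal.ofReal p)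
    (S.particleLaw N n)

/-- `‖k‖_∞ = sup_{n, x', x} k_n(x', x)`. -/
def kSup {E : Type*} (M : ℕ∞) (k : ℕ → E → E → ℝ) : ℝ :=
  sSup {a | ∃ n ∈ obsTimes M, ∃ x' x, a = k n x' x}

/-- `‖g‖_∞ = sup_{n, x} |g_n(x)|`. -/
def gSup {E : Type*} [MeasurableSpace E] (S : SSM E) (M : ℕ∞) : ℝ :=
  sSup {a | ∃ n ∈ obsTimes M, ∃ x, a = |S.lik n x|}

/-- The kernels have positive densities `k_n` w.r.t. `vol`, `‖k‖_∞ < ∞`, and the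
likelihoods are positive with `‖g‖_∞ < ∞`. -/
structure Regular {E : Type*} [MeasurableSpace E] (S : SSM E) (M : ℕ∞) (vol : Measure E)
    (k : ℕ → E → E → ℝ) : Prop where
  measurable : ∀ n ∈ obsTimes M, ∀ x', Measurable (k n x')
  pos : ∀ n ∈ obsTimes M, ∀ x' x, 0 < k n x' x
  density : ∀ n ∈ obsTimes M, ∀ x',
    S.kernel n x' = vol.withDensity fun x => ENNReal.ofReal (k n x' x)
  bdd : BddAbove {a | ∃ n ∈ obsTimes M, ∃ x' x, a = k n x' x}
  lik_pos : ∀ n ∈ obsTimes M, ∀ x, 0 < S.lik n x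
  lik_bdd : BddAbove {a | ∃ n ∈ obsTimes M, ∃ x, a = |S.lik n x|}

/-- The optimal filter is stable, with summable contraction rates `r`. -/
structure Stable {E : Type*} [MeasurableSpace E] (S : SSM E) (M : ℕ∞) (r : ℕ → ℝ) : Prop where
  anti : Antitone r
  zero : r 0 = 1
  summable : Summable r
  contract : ∀ m j : ℕ, ((m + j : ℕ) : ℕ∞) ≤ M → ∀ μ η : Measure E,
    IsProbabilityMeasure μ → IsProbabilityMeasure η →
      tvDist (S.puIter m j μ) (S.puIter m j η) ≤ r j * tvDist μ η

/-- The constraints `C l n` exhaust the state space as `l → ∞` and capture at least the mass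
`ε l` of the prior and of the transitions. -/
structure MassCondition {E : Type*} [MeasurableSpace E] [TopologicalSpace E] (S : SSM E)
    (M : ℕ∞) (C : ℕ → ℕ → TopologicalSpace.Compacts E) (ε : ℕ → ℝ) : Prop where
  exhaust : ∀ n : ℕ, (n : ℕ∞) ≤ M → ∀ x, ∀ᶠ l in atTop, x ∈ C l n
  pos : ∀ l, 0 < ε l
  mono : Monotone ε
  tendsto : Tendsto ε atTop (𝓝 1)
  init : ∀ l, ε l ≤ S.init.real (C l 0 : Set E)
  kernel : ∀ l, ∀ n ∈ obsTimes M, ∀ x' ∈ C l (n - 1),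
    ε l ≤ (S.kernel n x').real (C l n : Set E)

end SSM

end

/-! The error splits into a bias, from constraining the model, and a sampling error.

Bias: the prior and, at states inside the constraints, the kernels of the constrained model are
dominated by `1/ε` times the original ones. Swapping one step of the two models moves the filter by
`O(1/ε - 1)` in total variation; the `j` remaining steps of the stable model forget this at rate `r
j`. Telescoping over the swaps and summing `r` gives `c (1 - ε)/ε` (`Stable.abs_filter_sub_le`).

Sampling error: let `v_m = K_{m+1}(g_{m+1} ⋯ K_n(g_n f))` and let `u_m` be the same with `f = 1`.
The ratio `∑ v_m(x_m^i) / ∑ u_m(x_m^i)` is the empirical mean of `f` at `m = n`, while at `m = 0`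
the ratio of expectations is the filter itself. Each mutation and each resampling replaces a ratio
of conditional means by a ratio of sums over independent particles. Hoeffding's bound for `v - a u`,
with `a` the ratio of means, costs at most a multiple of `Λ D / √N`, where `Λ` bounds `u(x)/u(y)`
and `D` the oscillation of `v/u` (`eLpNorm_ratio_le`). The costs add up (`Confined.pfError_le`), so
a bounded `Λ` and a summable `D` give an error uniform in time.

Both inputs are obtained twice. Under the density bounds on the constraints, `Λ = 1/γ` and `D`
decays like `(1 - γ²)^j` (`Confined.bwd_ratio_of_mixing`, `Confined.bwd_osc_of_mixing`), which gives
the factor `γ^{-3}` of (i). In a stable model, `v/u` at `x` is the filter started from `δ_x`, so `D`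
is `2 r j`, and `Λ` is a convergent product of one-step ratios (`Stable.bwd_one_le`); this bound
does not involve the constraints.

Then (i) is bias plus sampling error, and in (ii) the limit is the largest bias over times and test
functions. For (iii), with `N` and `n` fixed, the constrained particle law is at most `ε^{-N(n+1)}`
times the unconstrained one (`Confined.particleLaw_le`), so the errors converge to those of the
particle filter run on `S`, which the stable bound controls. -/

/-! ### Moments of sub-Gaussian variables. -/

/-- A constant `b_p` with `‖Z‖_p ≤ b_p σ` for every `σ²`-sub-Gaussian variable `Z`. -/
noncomputable def momentConst (p : ℝ) : ℝ :=
  ((1 + (Nat.factorial ⌈p⌉₊ : ℝ)) * (2 * Real.exp (1 / 2))) ^ (1 / p)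

lemma momentConst_pos (p : ℝ) : 0 < momentConst p := by
  unfold momentConst; positivity

/-- Compare `|x|^p` with `1 + |x|^⌈p⌉`, and the integer power with one term of the exponential
series. -/
lemma rpow_abs_le_exp {p : ℝ} (hp : 1 ≤ p) (x : ℝ) :
    |x| ^ p ≤ (1 + (Nat.factorial ⌈p⌉₊ : ℝ)) * (Real.exp x + Real.exp (-x)) := by
  have h1 : |x| ^ p ≤ 1 + |x| ^ ⌈p⌉₊ := by
    rcases le_total |x| 1 with h | h
    · have := Real.rpow_le_one (abs_nonneg x) h (by linarith : 0 ≤ p)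
      have : 0 ≤ |x| ^ ⌈p⌉₊ := by positivity
      linarith
    · have : |x| ^ p ≤ |x| ^ ((⌈p⌉₊ : ℕ) : ℝ) := Real.rpow_le_rpow_of_exponent_le h (Nat.le_ceil p)
      rw [Real.rpow_natCast] at this
      linarith
  have hf : (0 : ℝ) < Nat.factorial ⌈p⌉₊ := by positivity
  have h2 : |x| ^ ⌈p⌉₊ ≤ Nat.factorial ⌈p⌉₊ * Real.exp |x| := by
    have := Real.pow_div_factorial_le_exp |x| (abs_nonneg x) ⌈p⌉₊
    rw [div_le_iff₀ hf] at this
    linarith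
  have h3 : Real.exp |x| ≤ Real.exp x + Real.exp (-x) := by
    rcases abs_cases x with ⟨h, _⟩ | ⟨h, _⟩ <;> rw [h]
    · linarith [Real.exp_pos (-x)]
    · linarith [Real.exp_pos x]
  have h4 : 1 ≤ Real.exp |x| := Real.one_le_exp (abs_nonneg x)
  calc |x| ^ p ≤ 1 + |x| ^ ⌈p⌉₊ := h1
    _ ≤ (1 + (Nat.factorial ⌈p⌉₊ : ℝ)) * Real.exp |x| := by linarith
    _ ≤ _ := by gcongr

lemma ProbabilityTheory.HasSubgaussianMGF.eLpNorm_le {Ω : Type*} [MeasurableSpace Ω]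
    {μ : Measure Ω} {S : Ω → ℝ} {c : NNReal} (h : HasSubgaussianMGF S c μ)
    {p : ℝ} (hp : 1 ≤ p) :
    eLpNorm S (ENNReal.ofReal p) μ ≤ ENNReal.ofReal (momentConst p * √c) := by
  have hp0 : 0 < p := by linarith
  by_cases hc : c = 0
  · subst hc
    rw [eLpNorm_congr_ae h.ae_eq_zero_of_hasSubgaussianMGF_zero]
    simp
  have hc' : (0 : ℝ) < c := by exact_mod_cast pos_iff_ne_zero.mpr hc
  set σ := √(c : ℝ) with hσ
  have hσ0 : 0 < σ := Real.sqrt_pos.mpr hc'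
  have hσ2 : σ ^ 2 = c := Real.sq_sqrt hc'.le
  set A : ℝ := 1 + (Nat.factorial ⌈p⌉₊ : ℝ) with hA
  have hA0 : 0 < A := by positivity
  have hint : ∀ t : ℝ, Integrable (fun ω => Real.exp (t * S ω)) μ := h.integrable_exp_mul
  -- At the scale `1/σ` the sub-Gaussian bound on the moment generating function is `exp (1/2)`, for
  -- both signs.
  have hval : ∀ t : ℝ, t ^ 2 = σ⁻¹ ^ 2 → ∫ ω, Real.exp (t * S ω) ∂μ ≤ Real.exp (1 / 2) := by
    intro t ht
    have := h.mgf_le t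
    rw [ht, ← hσ2] at this
    refine this.trans (le_of_eq ?_)
    congr 1
    field_simp
  rw [eLpNorm_eq_lintegral_rpow_enorm_toReal (by simpa using hp0) ENNReal.ofReal_ne_top,
    ENNReal.toReal_ofReal hp0.le]
  have key : ∫⁻ ω, ‖S ω‖ₑ ^ p ∂μ ≤ ENNReal.ofReal (σ ^ p * (A * (2 * Real.exp (1 / 2)))) := by
    calc ∫⁻ ω, ‖S ω‖ₑ ^ p ∂μ
        ≤ ∫⁻ ω, ENNReal.ofReal (σ ^ p * (A * (Real.exp (σ⁻¹ * S ω) + Real.exp (-σ⁻¹ * S ω)))) ∂μ := by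
          refine lintegral_mono fun ω => ?_
          rw [Real.enorm_eq_ofReal_abs, ENNReal.ofReal_rpow_of_nonneg (abs_nonneg _) hp0.le]
          refine ENNReal.ofReal_le_ofReal ?_
          have h1 := rpow_abs_le_exp hp (σ⁻¹ * S ω)
          have h2 : |S ω| ^ p = σ ^ p * |σ⁻¹ * S ω| ^ p := by
            rw [← Real.mul_rpow hσ0.le (abs_nonneg _), abs_mul, abs_of_pos (inv_pos.mpr hσ0)]
            congr 1
            field_simp
          rw [h2, neg_mul]
          gcongr
      _ = ENNReal.ofReal (∫ ω, σ ^ p * (A * (Real.exp (σ⁻¹ * S ω) + Real.exp (-σ⁻¹ * S ω))) ∂μ) := by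
          rw [ofReal_integral_eq_lintegral_ofReal]
          · exact (((hint _).add (hint _)).const_mul _).const_mul _
          · exact ae_of_all _ fun ω => by positivity
      _ ≤ _ := by
          refine ENNReal.ofReal_le_ofReal ?_
          rw [integral_const_mul, integral_const_mul, integral_add (hint _) (hint _)]
          have h1 := hval σ⁻¹ rfl
          have h2 := hval (-σ⁻¹) (by ring)
          have := add_le_add h1 h2
          rw [← two_mul] at this
          gcongr
  calc _ ≤ (ENNReal.ofReal (σ ^ p * (A * (2 * Real.exp (1 / 2))))) ^ (1 / p) := by gcongr
    _ = _ := by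
      rw [ENNReal.ofReal_rpow_of_nonneg (by positivity) (by positivity),
        Real.mul_rpow (by positivity) (by positivity), ← Real.rpow_mul hσ0.le,
        mul_one_div_cancel hp0.ne', Real.rpow_one, mul_comm]
      rfl

/-! ### One-step `L^p` estimates. -/

/-- Importance-weighted averages of independent particles: the `L^p` error of the ratio
`∑ v(yᵢ) / ∑ u(yᵢ)`. -/
lemma eLpNorm_ratio_le {E : Type*} [MeasurableSpace E] {N : ℕ} (hN : 1 ≤ N)
    (ν : Fin N → Measure E) [∀ i, IsProbabilityMeasure (ν i)] {A : Set E}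
    (hA : ∀ i, ∀ᵐ y ∂(ν i), y ∈ A) {u v : E → ℝ} (hu : Measurable u) (hv : Measurable v)
    (hupos : ∀ x ∈ A, 0 < u x) {Λ D : ℝ} (hΛ : ∀ x ∈ A, ∀ y ∈ A, u x ≤ Λ * u y)
    (hD : ∀ x ∈ A, ∀ y ∈ A, v x / u x - v y / u y ≤ D) {p : ℝ} (hp : 1 ≤ p) :
    eLpNorm (fun y : Fin N → E => (∑ i, v (y i)) / (∑ i, u (y i)) -
        (∑ i, ∫ z, v z ∂(ν i)) / (∑ i, ∫ z, u z ∂(ν i))) (ENNReal.ofReal p) (Measure.pi ν)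
      ≤ ENNReal.ofReal (momentConst p * Λ * D / √N) := by
  have hN0 : (0 : ℝ) < N := by exact_mod_cast hN
  have : Nonempty (Fin N) := ⟨⟨0, hN⟩⟩
  obtain ⟨x₀, hx₀⟩ : A.Nonempty := by
    obtain ⟨y, hy⟩ := (hA (Classical.arbitrary _)).exists
    exact ⟨y, hy⟩
  have hD0 : 0 ≤ D := by simpa using hD x₀ hx₀ x₀ hx₀
  have hΛ1 : 1 ≤ Λ := by
    have := hΛ x₀ hx₀ x₀ hx₀
    have h0 := hupos x₀ hx₀
    by_contra! hlt
    nlinarith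
  -- `s` is the supremum of `u` on `A`. It bounds the summands from above and, up to `Λ`, the
  -- denominator from below, so it cancels in the end.
  obtain ⟨s, hs0, hus, hsΛ⟩ : ∃ s : ℝ, 0 < s ∧ (∀ x ∈ A, u x ≤ s) ∧ ∀ x ∈ A, s ≤ Λ * u x := by
    have hb : BddAbove (u '' A) := ⟨Λ * u x₀, by rintro _ ⟨x, hx, rfl⟩; exact hΛ x hx x₀ hx₀⟩
    refine ⟨sSup (u '' A), (hupos x₀ hx₀).trans_le (le_csSup hb ⟨x₀, hx₀, rfl⟩),
      fun x hx => le_csSup hb ⟨x, hx, rfl⟩, fun x hx => csSup_le ⟨_, x₀, hx₀, rfl⟩ ?_⟩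
    rintro _ ⟨y, hy, rfl⟩
    exact hΛ y hy x hx
  have huint : ∀ i, Integrable u (ν i) := fun i =>
    Integrable.of_mem_Icc 0 s hu.aemeasurable
      ((hA i).mono fun y hy => ⟨(hupos y hy).le, hus y hy⟩)
  have hvb : ∀ y ∈ A, |v y| ≤ s * (|v x₀ / u x₀| + D) := by
    intro y hy
    have h0 := hupos y hy
    have h1 := hD y hy x₀ hx₀
    have h2 := hD x₀ hx₀ y hy
    have h3 : |v y / u y| ≤ |v x₀ / u x₀| + D := by
      rw [abs_le]; constructor <;> linarith [neg_abs_le (v x₀ / u x₀), le_abs_self (v x₀ / u x₀)]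
    calc |v y| = u y * |v y / u y| := by rw [abs_div, abs_of_pos h0]; field_simp
      _ ≤ _ := mul_le_mul (hus y hy) h3 (abs_nonneg _) hs0.le
  have hvint : ∀ i, Integrable v (ν i) := fun i =>
    Integrable.of_mem_Icc (-(s * (|v x₀ / u x₀| + D))) (s * (|v x₀ / u x₀| + D)) hv.aemeasurable
      ((hA i).mono fun y hy => abs_le.mp (hvb y hy))
  set U := ∑ i, ∫ z, u z ∂(ν i) with hU
  set V := ∑ i, ∫ z, v z ∂(ν i) with hV
  have hU0 : 0 < U := by
    refine Finset.sum_pos (fun i _ => ?_) Finset.univ_nonempty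
    calc 0 < s / Λ := by positivity
      _ = ∫ z, s / Λ ∂(ν i) := by simp
      _ ≤ ∫ z, u z ∂(ν i) := by
        refine integral_mono_ae (integrable_const _) (huint i) ((hA i).mono fun y hy => ?_)
        have := hsΛ y hy
        simp only
        rw [div_le_iff₀ (by linarith)]
        linarith
  -- `V / U` is a `u`-weighted average of `v / u` over `A`, hence within `D` of each of its values.
  have hosc : ∀ x ∈ A, |v x / u x - V / U| ≤ D := by
    intro x hx
    have h1 : v x / u x * U - V ≤ D * U := by
      rw [hU, hV, Finset.mul_sum, Finset.mul_sum, ← Finset.sum_sub_distrib]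
      refine Finset.sum_le_sum fun i _ => ?_
      rw [← integral_const_mul, ← integral_const_mul, ← integral_sub ((huint i).const_mul _) (hvint i)]
      refine integral_mono_ae (((huint i).const_mul _).sub (hvint i)) ((huint i).const_mul _)
        ((hA i).mono fun y hy => ?_)
      have h0 := hupos y hy
      have := mul_le_mul_of_nonneg_right (hD x hx y hy) h0.le
      rw [sub_mul, div_mul_cancel₀ _ h0.ne'] at this
      exact this
    have h2 : V - v x / u x * U ≤ D * U := by
      rw [hU, hV, Finset.mul_sum, Finset.mul_sum, ← Finset.sum_sub_distrib]
      refine Finset.sum_le_sum fun i _ => ?_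
      rw [← integral_const_mul, ← integral_const_mul, ← integral_sub (hvint i) ((huint i).const_mul _)]
      refine integral_mono_ae ((hvint i).sub ((huint i).const_mul _)) ((huint i).const_mul _)
        ((hA i).mono fun y hy => ?_)
      have h0 := hupos y hy
      have := mul_le_mul_of_nonneg_right (hD y hy x hx) h0.le
      rw [sub_mul, div_mul_cancel₀ _ h0.ne'] at this
      exact this
    have h3 : v x / u x - V / U = (v x / u x * U - V) / U := by field_simp
    rw [h3, abs_div, abs_of_pos hU0, div_le_iff₀ hU0, abs_le]
    constructor <;> linarith
  -- With `Z = v - a u` the error is `∑ Z(yᵢ) / ∑ u(yᵢ)`: the numerator is a sum of independent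
  -- bounded terms.
  set a := V / U with ha
  let Z : E → ℝ := fun y => v y - a * u y
  have hZm : Measurable Z := hv.sub (hu.const_mul _)
  have hZb : ∀ y ∈ A, Z y ∈ Set.Icc (-(s * D)) (s * D) := by
    intro y hy
    have h0 := hupos y hy
    have h1 : Z y = u y * (v y / u y - a) := by simp only [Z]; field_simp
    rw [Set.mem_Icc, ← abs_le, h1, abs_mul, abs_of_pos h0]
    exact mul_le_mul (hus y hy) (hosc y hy) (abs_nonneg _) hs0.le
  -- The laws `ν i` differ, so a single `Z(yᵢ)` need not be centred; only the sum of the means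
  -- vanishes, which is what Hoeffding's bound needs after centring each term.
  have hsum0 : ∑ i, ∫ z, Z z ∂(ν i) = 0 := by
    have : ∀ i, ∫ z, Z z ∂(ν i) = ∫ z, v z ∂(ν i) - a * ∫ z, u z ∂(ν i) := fun i => by
      simp only [Z]
      rw [integral_sub (hvint i) ((huint i).const_mul _), integral_const_mul]
    rw [Finset.sum_congr rfl fun i _ => this i, Finset.sum_sub_distrib, ← Finset.mul_sum, ← hU,
      ← hV, ha, div_mul_cancel₀ _ hU0.ne', sub_self]
  have hmp := measurePreserving_eval ν
  have hsub : HasSubgaussianMGF (fun y : Fin N → E => ∑ i, Z (y i))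
      (∑ _i : Fin N, (‖s * D - -(s * D)‖₊ / 2) ^ 2) (Measure.pi ν) := by
    have h1 : iIndepFun (fun i (y : Fin N → E) => Z (y i) - ∫ z, Z z ∂(ν i)) (Measure.pi ν) :=
      iIndepFun_pi (X := fun i y => Z y - ∫ z, Z z ∂(ν i)) fun i => (hZm.sub_const _).aemeasurable
    have h2 : ∀ i ∈ Finset.univ, HasSubgaussianMGF
        (fun y : Fin N → E => Z (y i) - ∫ z, Z z ∂(ν i)) ((‖s * D - -(s * D)‖₊ / 2) ^ 2)
        (Measure.pi ν) := by
      intro i _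
      have h3 := hasSubgaussianMGF_of_mem_Icc (μ := Measure.pi ν) (X := fun y => Z (y i))
        (a := -(s * D)) (b := s * D) (hZm.comp (measurable_pi_apply i)).aemeasurable
        ((hmp i).quasiMeasurePreserving.ae ((hA i).mono hZb))
      have h4 : ∫ y, Z (y i) ∂(Measure.pi ν) = ∫ z, Z z ∂(ν i) := by
        rw [← (hmp i).map_eq, integral_map (hmp i).aemeasurable hZm.aestronglyMeasurable]
      rwa [h4] at h3
    have h5 := HasSubgaussianMGF.sum_of_iIndepFun h1 h2
    simpa only [Finset.sum_sub_distrib, hsum0, sub_zero] using h5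
  have hall : ∀ᵐ y ∂(Measure.pi ν), ∀ i, y i ∈ A :=
    ae_all_iff.mpr fun i => (hmp i).quasiMeasurePreserving.ae (hA i)
  have hbound : ∀ᵐ y ∂(Measure.pi ν), ‖(∑ i, v (y i)) / (∑ i, u (y i)) - a‖
      ≤ (Λ / (N * s)) * ‖∑ i, Z (y i)‖ := by
    filter_upwards [hall] with y hy
    have h1 : N * s ≤ Λ * ∑ i, u (y i) := by
      rw [Finset.mul_sum]
      calc N * s = ∑ _i : Fin N, s := by simp
        _ ≤ _ := Finset.sum_le_sum fun i _ => hsΛ _ (hy i)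
    have h0 : 0 < ∑ i, u (y i) :=
      Finset.sum_pos (fun i _ => hupos _ (hy i)) Finset.univ_nonempty
    have h2 : (∑ i, v (y i)) / (∑ i, u (y i)) - a = (∑ i, Z (y i)) / ∑ i, u (y i) := by
      simp only [Z, Finset.sum_sub_distrib, ← Finset.mul_sum]
      field_simp
    rw [h2, norm_div, div_eq_mul_inv, mul_comm]
    gcongr
    rw [Real.norm_of_nonneg h0.le, inv_le_comm₀ h0 (by positivity), inv_div, div_le_iff₀ (by linarith)]
    linarith
  calc _ ≤ ENNReal.ofReal (Λ / (N * s)) *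
        eLpNorm (fun y : Fin N → E => ∑ i, Z (y i)) (ENNReal.ofReal p) (Measure.pi ν) :=
        eLpNorm_le_mul_eLpNorm_of_ae_le_mul hbound _
    _ ≤ ENNReal.ofReal (Λ / (N * s)) * ENNReal.ofReal (momentConst p * (√N * (s * D))) := by
        gcongr
        refine (hsub.eLpNorm_le hp).trans (le_of_eq ?_)
        congr 2
        have : (((∑ _i : Fin N, (‖s * D - -(s * D)‖₊ / 2) ^ 2 : NNReal)) : ℝ) = N * (s * D) ^ 2 := by
          push_cast
          rw [Real.norm_of_nonneg (by nlinarith [mul_nonneg hs0.le hD0])]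
          simp
        rw [this, Real.sqrt_mul hN0.le, Real.sqrt_sq (by positivity)]
    _ = _ := by
        rw [← ENNReal.ofReal_mul (by positivity)]
        congr 1
        have h0 : 0 < √(N : ℝ) := Real.sqrt_pos.mpr hN0
        field_simp
        rw [Real.sq_sqrt hN0.le]
        ring

/-- Minkowski's inequality on the joint law of `(x, y)`, with `G x` as the intermediate value. -/
lemma eLpNorm_bind_sub_const_le {α β : Type*} [MeasurableSpace α] [MeasurableSpace β]
    (μ : Measure α) [IsProbabilityMeasure μ] (κ : Kernel α β) [IsMarkovKernel κ]
    {F : β → ℝ} {G : α → ℝ} (hF : Measurable F) (hG : Measurable G) (a : ℝ) {p : ℝ} (hp : 1 ≤ p)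
    {δ : ℝ≥0∞} (h : ∀ᵐ x ∂μ, eLpNorm (fun y => F y - G x) (ENNReal.ofReal p) (κ x) ≤ δ) :
    eLpNorm (fun y => F y - a) (ENNReal.ofReal p) (μ.bind κ)
      ≤ eLpNorm (fun x => G x - a) (ENNReal.ofReal p) μ + δ := by
  have hp0 : 0 < p := by linarith
  have hpE : ENNReal.ofReal p ≠ 0 := by simpa using hp0
  have hp1 : 1 ≤ ENNReal.ofReal p := by simpa using hp
  rw [← Measure.snd_compProd, Measure.snd,
    eLpNorm_map_measure (hF.sub_const a).aestronglyMeasurable measurable_snd.aemeasurable]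
  have h1 : (fun y => F y - a) ∘ Prod.snd
      = (fun z : α × β => G z.1 - a) + fun z : α × β => F z.2 - G z.1 := by
    ext z; simp
  have hG' : Measurable fun z : α × β => G z.1 - a := (hG.comp measurable_fst).sub_const a
  have hFG : Measurable fun z : α × β => F z.2 - G z.1 :=
    (hF.comp measurable_snd).sub (hG.comp measurable_fst)
  rw [h1]
  refine (eLpNorm_add_le hG'.aestronglyMeasurable hFG.aestronglyMeasurable hp1).trans ?_
  gcongr
  · have h2 : (μ ⊗ₘ κ).map Prod.fst = μ := by
      have := Measure.fst_compProd μ κ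
      rwa [Measure.fst] at this
    conv_rhs => rw [← h2]
    rw [eLpNorm_map_measure (hG.sub_const a).aestronglyMeasurable measurable_fst.aemeasurable]
    rfl
  · rw [eLpNorm_eq_lintegral_rpow_enorm_toReal hpE ENNReal.ofReal_ne_top,
      ENNReal.toReal_ofReal hp0.le, Measure.lintegral_compProd (by fun_prop)]
    have h3 : ∫⁻ x, ∫⁻ y, ‖F y - G x‖ₑ ^ p ∂(κ x) ∂μ ≤ δ ^ p := by
      calc _ ≤ ∫⁻ _x, δ ^ p ∂μ := by
            refine lintegral_mono_ae (h.mono fun x hx => ?_)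
            rw [eLpNorm_eq_lintegral_rpow_enorm_toReal hpE ENNReal.ofReal_ne_top,
              ENNReal.toReal_ofReal hp0.le] at hx
            have := ENNReal.rpow_le_rpow hx hp0.le
            rwa [← ENNReal.rpow_mul, one_div_mul_cancel hp0.ne', ENNReal.rpow_one] at this
        _ = δ ^ p := by simp
    calc _ ≤ (δ ^ p) ^ (1 / p) := by gcongr
      _ = δ := by rw [← ENNReal.rpow_mul, mul_one_div_cancel hp0.ne', ENNReal.rpow_one]

/-! ### Integration of bounded measurable functions against Markov kernels. -/

/-- Bounded measurable functions. -/
def IsBddMeas {E : Type*} [MeasurableSpace E] (h : E → ℝ) : Prop :=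
  Measurable h ∧ ∃ B, ∀ x, |h x| ≤ B

section BddMeas

variable {E : Type*} [MeasurableSpace E]

lemma IsTest.isBddMeas {f : E → ℝ} (hf : IsTest f) : IsBddMeas f := ⟨hf.1, 1, hf.2⟩

lemma isBddMeas_const (c : ℝ) : IsBddMeas fun _ : E => c :=
  ⟨measurable_const, |c|, fun _ => le_rfl⟩

lemma IsBddMeas.mul {f h : E → ℝ} (hf : IsBddMeas f) (hh : IsBddMeas h) :
    IsBddMeas fun x => f x * h x := by
  obtain ⟨hf, B, hB⟩ := hf
  obtain ⟨hh, C, hC⟩ := hh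
  refine ⟨hf.mul hh, B * C, fun x => ?_⟩
  rw [abs_mul]
  exact mul_le_mul (hB x) (hC x) (abs_nonneg _) ((abs_nonneg _).trans (hB x))

lemma IsBddMeas.integrable {h : E → ℝ} (hh : IsBddMeas h) (μ : Measure E) [IsFiniteMeasure μ] :
    Integrable h μ := by
  obtain ⟨hh, B, hB⟩ := hh
  exact Integrable.of_mem_Icc (-B) B hh.aemeasurable (ae_of_all _ fun x => abs_le.mp (hB x))

lemma abs_integral_le_of_abs_le {μ : Measure E} [IsProbabilityMeasure μ] {h : E → ℝ} {B : ℝ}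
    (hB : ∀ x, |h x| ≤ B) : |∫ x, h x ∂μ| ≤ B := by
  have := norm_integral_le_of_norm_le_const (μ := μ) (f := h) (C := B) (ae_of_all _ hB)
  simpa using this

lemma IsBddMeas.kernel {F : Type*} [MeasurableSpace F] {h : F → ℝ} (hh : IsBddMeas h)
    (κ : Kernel E F) [IsMarkovKernel κ] : IsBddMeas fun x => ∫ y, h y ∂(κ x) :=
  ⟨(hh.1.stronglyMeasurable.integral_kernel (κ := κ)).measurable, hh.2.choose,
    fun _ => abs_integral_le_of_abs_le hh.2.choose_spec⟩

lemma IsBddMeas.integral_bind {F : Type*} [MeasurableSpace F] {h : F → ℝ} (hh : IsBddMeas h)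
    (μ : Measure E) [IsProbabilityMeasure μ] (κ : Kernel E F) [IsMarkovKernel κ] :
    ∫ y, h y ∂(μ.bind κ) = ∫ x, ∫ y, h y ∂(κ x) ∂μ := by
  rw [← Measure.snd_compProd, Measure.snd,
    integral_map measurable_snd.aemeasurable hh.1.aestronglyMeasurable,
    Measure.integral_compProd]
  exact IsBddMeas.integrable ⟨hh.1.comp measurable_snd, hh.2.choose,
    fun x => hh.2.choose_spec x.2⟩ _

lemma IsBddMeas.integral_pos (μ : Measure E) [IsProbabilityMeasure μ] {h : E → ℝ}
    (hh : IsBddMeas h) (hpos : ∀ x, 0 < h x) : 0 < ∫ x, h x ∂μ := by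
  rw [integral_pos_iff_support_of_nonneg (fun y => (hpos y).le) (hh.integrable μ)]
  have : Function.support h = Set.univ := Set.eq_univ_of_forall fun y => (hpos y).ne'
  simp [this]

end BddMeas

/-! ### Mutation and resampling as Markov kernels. -/

section Particles

variable {E : Type*} [MeasurableSpace E]

lemma measurable_pi_of_isProbabilityMeasure {α ι : Type*} [MeasurableSpace α] [Fintype ι]
    {μ : α → ι → Measure E} (hp : ∀ a i, IsProbabilityMeasure (μ a i))
    (hm : ∀ i, Measurable fun a => μ a i) : Measurable fun a => Measure.pi (μ a) := by
  refine Measurable.measure_of_isPiSystem_of_isProbabilityMeasure generateFrom_pi.symm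
    isPiSystem_pi ?_
  rintro _ ⟨s, hs, rfl⟩
  simp only [Measure.pi_pi]
  exact Finset.measurable_prod _ fun i _ =>
    (Measure.measurable_coe (hs i (Set.mem_univ i))).comp (hm i)

/-- `mutate` as a kernel. -/
noncomputable def mutateKernel (κ : Kernel E E) [IsMarkovKernel κ] (N : ℕ) :
    Kernel (Fin N → E) (Fin N → E) where
  toFun := mutate κ
  measurable' := measurable_pi_of_isProbabilityMeasure (fun _ _ => inferInstance)
    fun i => κ.measurable.comp (measurable_pi_apply i)

instance (κ : Kernel E E) [IsMarkovKernel κ] (N : ℕ) : IsMarkovKernel (mutateKernel κ N) :=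
  ⟨fun x => inferInstanceAs (IsProbabilityMeasure (Measure.pi fun i => κ (x i)))⟩

lemma integral_weighted {g : E → ℝ} (hg : ∀ x, 0 < g x) {N : ℕ} (x : Fin N → E) {h : E → ℝ}
    (hh : Measurable h) :
    ∫ y, h y ∂(weighted g x) = (∑ i, g (x i) * h (x i)) / ∑ i, g (x i) := by
  rw [weighted, integral_finsetSum_measure, Finset.sum_div]
  · refine Finset.sum_congr rfl fun i _ => ?_
    rw [integral_smul_measure, integral_dirac' _ _ hh.stronglyMeasurable, ENNReal.toReal_ofReal]
    · simp only [smul_eq_mul]; ring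
    · exact div_nonneg (hg _).le (Finset.sum_nonneg fun i _ => (hg _).le)
  · intro i _
    refine Integrable.smul_measure ?_ ENNReal.ofReal_ne_top
    exact (integrable_dirac' hh.stronglyMeasurable (by simp))

lemma isProbabilityMeasure_weighted {g : E → ℝ} (hg : ∀ x, 0 < g x) {N : ℕ} (hN : 1 ≤ N)
    (x : Fin N → E) : IsProbabilityMeasure (weighted g x) := by
  have : Nonempty (Fin N) := ⟨⟨0, hN⟩⟩
  have hs : 0 < ∑ i, g (x i) := Finset.sum_pos (fun i _ => hg _) Finset.univ_nonempty
  constructor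
  simp only [weighted, Measure.coe_finsetSum, Finset.sum_apply, Measure.smul_apply, measure_univ,
    smul_eq_mul, mul_one]
  rw [← ENNReal.ofReal_sum_of_nonneg fun i _ => (div_pos (hg _) hs).le, ← Finset.sum_div,
    div_self hs.ne', ENNReal.ofReal_one]

lemma ae_weighted_mem {g : E → ℝ} {N : ℕ} {x : Fin N → E} {A : Set E} (hA : MeasurableSet A)
    (hx : ∀ i, x i ∈ A) : ∀ᵐ y ∂(weighted g x), y ∈ A := by
  rw [ae_iff]
  simp only [weighted, Measure.coe_finsetSum, Finset.sum_apply, Measure.smul_apply, smul_eq_mul]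
  refine Finset.sum_eq_zero fun i _ => ?_
  have : Measure.dirac (x i) {y | y ∉ A} = 0 := by
    change Measure.dirac (x i) Aᶜ = 0
    rw [Measure.dirac_apply' _ hA.compl]
    simp [hx i]
  rw [this, mul_zero]

lemma measurable_weighted {g : E → ℝ} (hg : Measurable g) (N : ℕ) :
    Measurable fun x : Fin N → E => weighted g x := by
  refine Measure.measurable_of_measurable_coe _ fun s hs => ?_
  simp only [weighted, Measure.coe_finsetSum, Finset.sum_apply, Measure.smul_apply, smul_eq_mul,
    Measure.dirac_apply' _ hs]
  refine Finset.measurable_sum _ fun i _ => Measurable.mul ?_ ?_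
  · exact ((hg.comp (measurable_pi_apply i)).div
      (Finset.measurable_sum _ fun j _ => hg.comp (measurable_pi_apply j))).ennreal_ofReal
  · exact (measurable_one.indicator hs).comp (measurable_pi_apply i)

/-- `resample` as a kernel. -/
noncomputable def resampleKernel (g : E → ℝ) (hg : Measurable g) (hpos : ∀ x, 0 < g x) {N : ℕ}
    (hN : 1 ≤ N) : Kernel (Fin N → E) (Fin N → E) where
  toFun := resample g
  measurable' := measurable_pi_of_isProbabilityMeasure
    (fun _ _ => isProbabilityMeasure_weighted hpos hN _) fun _ => measurable_weighted hg N

lemma isMarkovKernel_resampleKernel (g : E → ℝ) (hg : Measurable g) (hpos : ∀ x, 0 < g x) {N : ℕ}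
    (hN : 1 ≤ N) : IsMarkovKernel (resampleKernel g hg hpos hN) :=
  ⟨fun x => by
    have := isProbabilityMeasure_weighted hpos hN x
    exact inferInstanceAs (IsProbabilityMeasure (Measure.pi fun _ : Fin N => weighted g x))⟩

lemma measurableSet_forall_mem {N : ℕ} {B : Set E} (hB : MeasurableSet B) :
    MeasurableSet {x : Fin N → E | ∀ i, x i ∈ B} := by
  have := MeasurableSet.univ_pi fun _ : Fin N => hB
  convert this using 1
  ext x; simp

lemma ae_pi_forall_mem {N : ℕ} (μ : Fin N → Measure E) [∀ i, IsProbabilityMeasure (μ i)]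
    {B : Set E} (h : ∀ i, ∀ᵐ x ∂(μ i), x ∈ B) : ∀ᵐ x ∂(Measure.pi μ), ∀ i, x i ∈ B :=
  ae_all_iff.mpr fun i => (measurePreserving_eval μ i).quasiMeasurePreserving.ae (h i)

lemma integral_empirical {N : ℕ} (x : Fin N → E) {h : E → ℝ} (hh : Measurable h) :
    ∫ y, h y ∂(empirical x) = (∑ i, h (x i)) / N := by
  rw [empirical, integral_smul_measure, integral_finsetSum_measure]
  · simp only [integral_dirac' _ _ hh.stronglyMeasurable, smul_eq_mul, ENNReal.toReal_inv,
      ENNReal.toReal_natCast]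
    rw [div_eq_inv_mul]
  · intro i _
    exact integrable_dirac' hh.stronglyMeasurable (by simp)

end Particles

/-! ### Backward functions and the optimal filter. -/

namespace SSM

variable {E : Type*} [MeasurableSpace E]

/-- The operator `h ↦ K_n(g_n h)`. -/
noncomputable def step (S : SSM E) (n : ℕ) (h : E → ℝ) : E → ℝ :=
  fun x => ∫ y, S.lik n y * h y ∂(S.kernel n x)

/-- The unnormalized operators `h ↦ K_{m+1}(g_{m+1} ⋯ K_{m+j}(g_{m+j} h))`. -/
noncomputable def bwd (S : SSM E) (h : E → ℝ) : ℕ → ℕ → E → ℝ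
  | _, 0 => h
  | m, j + 1 => S.step (m + 1) (bwd S h (m + 1) j)

/-- A Markov state space model with likelihoods in `[ζ, G]`, whose prior and transitions at time
`n` are carried by `A n`. -/
structure Confined (S : SSM E) (M : ℕ∞) (A : ℕ → Set E) (ζ G : ℝ) : Prop extends
    S.IsMarkov M where
  measurableSet : ∀ n : ℕ, (n : ℕ∞) ≤ M → MeasurableSet (A n)
  init_mem : ∀ᵐ x ∂S.init, x ∈ A 0
  kernel_mem : ∀ n ∈ obsTimes M, ∀ x, ∀ᵐ y ∂(S.kernel n x), y ∈ A n
  zeta_pos : 0 < ζ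
  zeta_le : ζ ≤ G
  le_lik : ∀ n ∈ obsTimes M, ∀ x, ζ ≤ S.lik n x
  lik_le : ∀ n ∈ obsTimes M, ∀ x, S.lik n x ≤ G

lemma mem_obsTimes_succ {M : ℕ∞} {m j : ℕ} (h : ((m + (j + 1) : ℕ) : ℕ∞) ≤ M) :
    m + 1 ∈ obsTimes M :=
  ⟨by omega, le_trans (by exact_mod_cast (by omega : m + 1 ≤ m + (j + 1))) h⟩

variable {S : SSM E} {M : ℕ∞} {A : ℕ → Set E} {ζ G : ℝ}

namespace Confined

lemma lik_pos (hS : S.Confined M A ζ G) {n : ℕ} (hn : n ∈ obsTimes M) (x : E) : 0 < S.lik n x :=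
  hS.zeta_pos.trans_le (hS.le_lik n hn x)

lemma isBddMeas_lik (hS : S.Confined M A ζ G) {n : ℕ} (hn : n ∈ obsTimes M) :
    IsBddMeas (S.lik n) :=
  ⟨hS.lik n hn, G, fun x => by
    rw [abs_of_pos (hS.lik_pos hn x)]; exact hS.lik_le n hn x⟩

lemma isBddMeas_step (hS : S.Confined M A ζ G) {n : ℕ} (hn : n ∈ obsTimes M) {h : E → ℝ}
    (hh : IsBddMeas h) : IsBddMeas (S.step n h) := by
  have := hS.kernel n hn
  exact ((hS.isBddMeas_lik hn).mul hh).kernel _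

lemma isBddMeas_bwd (hS : S.Confined M A ζ G) {h : E → ℝ} (hh : IsBddMeas h) :
    ∀ (j m : ℕ), ((m + j : ℕ) : ℕ∞) ≤ M → IsBddMeas (S.bwd h m j)
  | 0, _, _ => hh
  | j + 1, m, hm => hS.isBddMeas_step (mem_obsTimes_succ hm)
      (hS.isBddMeas_bwd hh j (m + 1) (by rwa [add_right_comm, add_assoc]))

lemma step_pos (hS : S.Confined M A ζ G) {n : ℕ} (hn : n ∈ obsTimes M) {h : E → ℝ}
    (hh : IsBddMeas h) (hpos : ∀ x, 0 < h x) (x : E) : 0 < S.step n h x := by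
  have := hS.kernel n hn
  exact ((hS.isBddMeas_lik hn).mul hh).integral_pos _ fun y =>
    mul_pos (hS.lik_pos hn y) (hpos y)

lemma bwd_pos (hS : S.Confined M A ζ G) {h : E → ℝ} (hh : IsBddMeas h) (hpos : ∀ x, 0 < h x) :
    ∀ (j m : ℕ), ((m + j : ℕ) : ℕ∞) ≤ M → ∀ x, 0 < S.bwd h m j x
  | 0, _, _, x => hpos x
  | j + 1, m, hm, x => by
      have hm' : ((m + 1 + j : ℕ) : ℕ∞) ≤ M := by rwa [add_right_comm, add_assoc]
      exact hS.step_pos (mem_obsTimes_succ hm) (hS.isBddMeas_bwd hh j _ hm')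
        (hS.bwd_pos hh hpos j _ hm') x

lemma integral_pu (hS : S.Confined M A ζ G) {n : ℕ} (hn : n ∈ obsTimes M) (μ : Measure E)
    [IsProbabilityMeasure μ] {h : E → ℝ} (hh : IsBddMeas h) :
    ∫ x, h x ∂(S.pu n μ) = (∫ x, S.step n h x ∂μ) / ∫ x, S.step n (fun _ => 1) x ∂μ := by
  have := hS.kernel n hn
  have hg := hS.isBddMeas_lik hn
  have key : ∀ {h : E → ℝ}, IsBddMeas h →
      ∫ x, h x ∂((μ.bind (S.kernel n)).withDensity fun x => ENNReal.ofReal (S.lik n x))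
        = ∫ x, S.step n h x ∂μ := by
    intro h hh
    rw [integral_withDensity_eq_integral_toReal_smul hg.1.ennreal_ofReal
      (ae_of_all _ fun _ => ENNReal.ofReal_lt_top)]
    simp only [ENNReal.toReal_ofReal (hS.lik_pos hn _).le, smul_eq_mul]
    rw [(hg.mul hh).integral_bind]
    rfl
  have h1 := key (isBddMeas_const 1)
  rw [pu, integral_smul_measure, key hh, ← h1]
  simp only [integral_const, smul_eq_mul, mul_one, Measure.real, ENNReal.toReal_inv]
  rw [div_eq_inv_mul]

lemma isProbabilityMeasure_pu (hS : S.Confined M A ζ G) {n : ℕ} (hn : n ∈ obsTimes M)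
    (μ : Measure E) [IsProbabilityMeasure μ] : IsProbabilityMeasure (S.pu n μ) := by
  have h1 := hS.integral_pu hn μ (isBddMeas_const 1)
  have := IsBddMeas.integral_pos μ (hS.isBddMeas_step hn (isBddMeas_const 1))
    (hS.step_pos hn (isBddMeas_const 1) fun _ => one_pos)
  rw [div_self this.ne'] at h1
  simp only [integral_const, smul_eq_mul, mul_one, Measure.real] at h1
  exact ⟨(ENNReal.toReal_eq_one_iff _).mp h1⟩

lemma ae_pu_mem (hS : S.Confined M A ζ G) {n : ℕ} (hn : n ∈ obsTimes M) (μ : Measure E) :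
    ∀ᵐ x ∂(S.pu n μ), x ∈ A n := by
  have := hS.kernel n hn
  rw [pu]
  refine Measure.ae_smul_measure ((withDensity_absolutelyContinuous _ _).ae_le ?_) _
  exact Measure.ae_comp_of_ae_ae (hS.measurableSet n hn.2)
    (ae_of_all _ fun x => hS.kernel_mem n hn x)

end Confined

/-- `puIter` is defined by adding the latest step and `bwd` by adding the earliest. This lemma and
`bwd_succ_right` peel each of them from the other end. -/
lemma puIter_succ_left (S : SSM E) (m : ℕ) (μ : Measure E) :
    ∀ j, S.puIter m (j + 1) μ = S.puIter (m + 1) j (S.pu (m + 1) μ)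
  | 0 => rfl
  | j + 1 => by
      rw [puIter, puIter_succ_left S m μ j, puIter, add_right_comm m 1 j, add_assoc m j 1]

lemma filter_eq_puIter (S : SSM E) : ∀ n, S.filter n = S.puIter 0 n S.init
  | 0 => rfl
  | n + 1 => by rw [filter, filter_eq_puIter S n, puIter, zero_add]

lemma bwd_succ_right (S : SSM E) (h : E → ℝ) :
    ∀ j m, S.bwd h m (j + 1) = S.bwd (S.step (m + j + 1) h) m j
  | 0, _ => rfl
  | j + 1, m => by
      rw [bwd, bwd_succ_right S h j (m + 1), bwd, add_right_comm m 1 j, add_assoc m j 1]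

namespace Confined

lemma isProbabilityMeasure_puIter (hS : S.Confined M A ζ G) (μ : Measure E)
    [IsProbabilityMeasure μ] (m : ℕ) :
    ∀ j, ((m + j : ℕ) : ℕ∞) ≤ M → IsProbabilityMeasure (S.puIter m j μ)
  | 0, _ => inferInstanceAs (IsProbabilityMeasure μ)
  | j + 1, h => by
      have := hS.isProbabilityMeasure_puIter μ m j
        (le_trans (by exact_mod_cast (by omega : m + j ≤ m + (j + 1))) h)
      exact hS.isProbabilityMeasure_pu ⟨by omega, h⟩ _

/-- Normalizing at every step or once at the end is the same, because the intermediate total masses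
cancel. This makes the filter a ratio of two linear functionals of `μ`. -/
lemma integral_puIter (hS : S.Confined M A ζ G) {h : E → ℝ} (hh : IsBddMeas h) :
    ∀ (j m : ℕ), ((m + j : ℕ) : ℕ∞) ≤ M → ∀ (μ : Measure E) [IsProbabilityMeasure μ],
      ∫ x, h x ∂(S.puIter m j μ) = (∫ x, S.bwd h m j x ∂μ) / ∫ x, S.bwd (fun _ => 1) m j x ∂μ
  | 0, _, _, μ, _ => by simp [puIter, bwd]
  | j + 1, m, hm, μ, _ => by
      have hm' : ((m + 1 + j : ℕ) : ℕ∞) ≤ M := by rwa [add_right_comm, add_assoc]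
      have hn := mem_obsTimes_succ hm
      have := hS.isProbabilityMeasure_pu hn μ
      have h1 := isBddMeas_const (E := E) 1
      have h2 := IsBddMeas.integral_pos μ (hS.isBddMeas_step hn h1) (hS.step_pos hn h1 fun _ => one_pos)
      rw [puIter_succ_left, hS.integral_puIter hh j (m + 1) hm',
        hS.integral_pu hn μ (hS.isBddMeas_bwd hh j _ hm'),
        hS.integral_pu hn μ (hS.isBddMeas_bwd h1 j _ hm'), div_div_div_cancel_right₀ h2.ne']
      rfl

lemma isProbabilityMeasure_filter (hS : S.Confined M A ζ G) {n : ℕ} (hn : (n : ℕ∞) ≤ M) :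
    IsProbabilityMeasure (S.filter n) := by
  have := hS.init
  rw [filter_eq_puIter]
  exact hS.isProbabilityMeasure_puIter _ 0 n (by simpa using hn)

lemma ae_filter_mem (hS : S.Confined M A ζ G) :
    ∀ {n : ℕ}, (n : ℕ∞) ≤ M → ∀ᵐ x ∂(S.filter n), x ∈ A n
  | 0, _ => hS.init_mem
  | n + 1, h => hS.ae_pu_mem ⟨by omega, h⟩ _

/-! ### Propagation of the sampling error through the particle filter. -/

lemma particleLaw_succ (hS : S.Confined M A ζ G) {n : ℕ} (hn : n + 1 ∈ obsTimes M) {N : ℕ}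
    (hN : 1 ≤ N) :
    ∃ (_ : IsMarkovKernel (S.kernel (n + 1))),
      S.particleLaw N (n + 1) = ((S.particleLaw N n).bind
        (mutateKernel (S.kernel (n + 1)) N)).bind
        (resampleKernel (S.lik (n + 1)) (hS.lik _ hn) (hS.lik_pos hn) hN) :=
  ⟨hS.kernel _ hn, rfl⟩

lemma isProbabilityMeasure_particleLaw (hS : S.Confined M A ζ G) {N : ℕ} (hN : 1 ≤ N) :
    ∀ {n : ℕ}, (n : ℕ∞) ≤ M → IsProbabilityMeasure (S.particleLaw N n)
  | 0, _ => by
      have := hS.init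
      exact inferInstanceAs (IsProbabilityMeasure (Measure.pi fun _ : Fin N => S.init))
  | n + 1, h => by
      have := hS.isProbabilityMeasure_particleLaw hN (n := n)
        (le_trans (by exact_mod_cast Nat.le_succ n) h)
      obtain ⟨hk, e⟩ := hS.particleLaw_succ (n := n) ⟨by omega, h⟩ hN
      have := isMarkovKernel_resampleKernel (S.lik (n + 1)) (hS.lik _ ⟨by omega, h⟩)
        (hS.lik_pos ⟨by omega, h⟩) hN
      rw [e]
      infer_instance

/-- `L^p` error of the bootstrap particle filter, from the ratios of the total masses and the
oscillations of the normalized backward functions. -/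
lemma pfError_le (hS : S.Confined M A ζ G) {N : ℕ} (hN : 1 ≤ N) {n : ℕ} (hn : (n : ℕ∞) ≤ M)
    {f : E → ℝ} (hf : IsBddMeas f) {Λ : ℝ} {D : ℕ → ℝ}
    (hΛ : ∀ m j, m + j = n → ∀ x ∈ A m, ∀ y ∈ A m,
      S.bwd (fun _ => 1) m j x ≤ Λ * S.bwd (fun _ => 1) m j y)
    (hD : ∀ m j, m + j = n → ∀ x ∈ A m, ∀ y ∈ A m,
      S.bwd f m j x / S.bwd (fun _ => 1) m j x - S.bwd f m j y / S.bwd (fun _ => 1) m j y ≤ D j)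
    {p : ℝ} (hp : 1 ≤ p) :
    S.pfError (S.filter n) N n p f ≤
      ENNReal.ofReal (momentConst p * (G / ζ + 1) * Λ * (∑ j ∈ Finset.range (n + 1), D j) / √N) := by
  have hinit := hS.init
  have : Nonempty (Fin N) := ⟨⟨0, hN⟩⟩
  have hN0 : (N : ℝ) ≠ 0 := by exact_mod_cast (by omega : N ≠ 0)
  have h1 := isBddMeas_const (E := E) 1
  set a := ∫ x, f x ∂(S.filter n) with ha
  have ha' : a = (∫ x, S.bwd f 0 n x ∂S.init) / ∫ x, S.bwd (fun _ => 1) 0 n x ∂S.init := by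
    rw [ha, filter_eq_puIter, hS.integral_puIter hf n 0 (by simpa using hn)]
  have hbM : ∀ {h : E → ℝ}, IsBddMeas h → ∀ m j, m + j = n → Measurable (S.bwd h m j) :=
    fun hh m j e => (hS.isBddMeas_bwd hh j m (by rwa [e])).1
  have hpos : ∀ m j, m + j = n → ∀ x, 0 < S.bwd (fun _ => 1) m j x := fun m j e =>
    hS.bwd_pos h1 (fun _ => one_pos) j m (by rwa [e])
  have hG : 0 < G := hS.zeta_pos.trans_le hS.zeta_le
  have hζ := hS.zeta_pos
  have hsumM : ∀ {h : E → ℝ}, Measurable h → Measurable fun x : Fin N → E => ∑ i, h (x i) :=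
    fun hh => Finset.measurable_sum _ fun i _ => hh.comp (measurable_pi_apply i)
  have hD0 : ∀ m j, m + j = n → 0 ≤ D j := by
    intro m j e
    obtain ⟨x, hx⟩ : (A m).Nonempty := by
      have hm : (m : ℕ∞) ≤ M := le_trans (by exact_mod_cast (by omega : m ≤ n)) hn
      have := hS.isProbabilityMeasure_filter hm
      exact (hS.ae_filter_mem hm).exists
    simpa using hD m j e x hx x hx
  have hΛ0 : 0 ≤ Λ := by
    obtain ⟨x, hx⟩ := hS.init_mem.exists
    by_contra! h
    nlinarith [hΛ 0 n (by simp) x hx x hx, hpos 0 n (by simp) x]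
  -- The tracked quantity is the prediction, made from the particles at time `m`, of the filter mean
  -- of `f` at time `n`.
  have main : ∀ m j, m + j = n →
      eLpNorm (fun x : Fin N → E =>
        (∑ i, S.bwd f m j (x i)) / (∑ i, S.bwd (fun _ => 1) m j (x i)) - a)
        (ENNReal.ofReal p) (S.particleLaw N m) ≤
      ENNReal.ofReal (momentConst p * (G / ζ + 1) * Λ *
        (∑ i ∈ Finset.range (m + 1), D (n - i)) / √N) := by
    intro m
    induction m with
    | zero =>
      intro j e
      obtain rfl : j = n := by omega
      have := eLpNorm_ratio_le hN (fun _ => S.init) (A := A 0) (fun _ => hS.init_mem)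
        (hbM h1 0 j e) (hbM hf 0 j e) (fun x _ => hpos 0 j e x) (hΛ 0 j e) (hD 0 j e) hp
      simp only [Finset.sum_const, Finset.card_univ, Fintype.card_fin, nsmul_eq_mul] at this
      rw [mul_div_mul_left _ _ hN0, ← ha'] at this
      refine this.trans (ENNReal.ofReal_le_ofReal ?_)
      have := momentConst_pos p
      have := hD0 0 j e
      simp only [zero_add, Finset.sum_range_one, Nat.sub_zero]
      gcongr
      -- The initial sampling costs a single `Λ D n`; it is enlarged to the factor `G / ζ + 1` of
      -- the other times.
      refine le_mul_of_one_le_right (by positivity) ?_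
      linarith [div_pos hG hζ]
    | succ m ih =>
      intro j e
      have e' : m + (j + 1) = n := by omega
      have hm1 : m + 1 ∈ obsTimes M :=
        mem_obsTimes_succ (m := m) (j := j) (by rwa [e'])
      have hmM : (m : ℕ∞) ≤ M := le_trans (by exact_mod_cast Nat.le_succ m) hm1.2
      have ih := ih (j + 1) e'
      obtain ⟨hk, el⟩ := hS.particleLaw_succ hm1 hN
      have hR := isMarkovKernel_resampleKernel (S.lik (m + 1)) (hS.lik _ hm1) (hS.lik_pos hm1) hN
      have hlaw := hS.isProbabilityMeasure_particleLaw hN hmM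
      set u := S.bwd (fun _ => 1) (m + 1) j with hu
      set v := S.bwd f (m + 1) j with hv
      set g := S.lik (m + 1) with hg
      have hgm : Measurable g := hS.lik _ hm1
      have hgpos : ∀ x, 0 < g x := hS.lik_pos hm1
      have hum : Measurable u := hbM h1 _ _ e
      have hvm : Measurable v := hbM hf _ _ e
      have hupos : ∀ x, 0 < u x := hpos _ _ e
      have hbind : ∀ᵐ x ∂((S.particleLaw N m).bind (mutateKernel (S.kernel (m + 1)) N)),
          ∀ i, x i ∈ A (m + 1) := by
        exact Measure.ae_comp_of_ae_ae (measurableSet_forall_mem (hS.measurableSet _ hm1.2))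
          (ae_of_all _ fun x => ae_pi_forall_mem (fun i => S.kernel (m + 1) (x i))
            fun i => hS.kernel_mem _ hm1 _)
      -- Resampling: the common law is the weighted measure, whose ratio of means is `∑ g v / ∑ g
      -- u`.
      have hres := eLpNorm_bind_sub_const_le
        ((S.particleLaw N m).bind (mutateKernel (S.kernel (m + 1)) N))
        (resampleKernel g hgm hgpos hN)
        (F := fun x => (∑ i, v (x i)) / (∑ i, u (x i)))
        (G := fun x => (∑ i, g (x i) * v (x i)) / (∑ i, g (x i) * u (x i)))
        ((hsumM hvm).div (hsumM hum)) ((hsumM (hgm.mul hvm)).div (hsumM (hgm.mul hum))) a hp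
        (δ := ENNReal.ofReal (momentConst p * Λ * D j / √N)) (by
          filter_upwards [hbind] with x hx
          have := isProbabilityMeasure_weighted hgpos hN x
          have hgs : 0 < ∑ i, g (x i) := Finset.sum_pos (fun i _ => hgpos _) Finset.univ_nonempty
          have h3 := eLpNorm_ratio_le hN (fun _ => weighted g x)
            (fun _ => ae_weighted_mem (hS.measurableSet _ hm1.2) hx) hum hvm (fun x _ => hupos x)
            (hΛ _ _ e) (hD _ _ e) hp
          simp only [Finset.sum_const, Finset.card_univ, Fintype.card_fin, nsmul_eq_mul,
            integral_weighted hgpos x hum, integral_weighted hgpos x hvm] at h3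
          rwa [mul_div_mul_left _ _ hN0, div_div_div_cancel_right₀ hgs.ne'] at h3)
      -- Mutation: `g v` and `g u` average under the kernel to the backward functions at time `m`.
      -- The ratio `g v / (g u)` is still `v / u`, so only `Λ` grows, by `G / ζ`.
      have hmut := eLpNorm_bind_sub_const_le (S.particleLaw N m) (mutateKernel (S.kernel (m + 1)) N)
        (F := fun x => (∑ i, g (x i) * v (x i)) / (∑ i, g (x i) * u (x i)))
        (G := fun x => (∑ i, S.bwd f m (j + 1) (x i)) / (∑ i, S.bwd (fun _ => 1) m (j + 1) (x i)))
        ((hsumM (hgm.mul hvm)).div (hsumM (hgm.mul hum)))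
        ((hsumM (hbM hf _ _ e')).div (hsumM (hbM h1 _ _ e'))) a hp
        (δ := ENNReal.ofReal (momentConst p * (G / ζ * Λ) * D j / √N)) (ae_of_all _ fun x => by
          refine eLpNorm_ratio_le hN (fun i => S.kernel (m + 1) (x i)) (A := A (m + 1))
            (fun i => hS.kernel_mem _ hm1 _) (hgm.mul hum) (hgm.mul hvm)
            (fun y _ => mul_pos (hgpos y) (hupos y)) ?_ ?_ hp
          · intro y hy z hz
            have hz0 := hS.le_lik _ hm1 z
            calc g y * u y ≤ G * (Λ * u z) :=
                  mul_le_mul (hS.lik_le _ hm1 y) (hΛ _ _ e y hy z hz) (hupos y).le hG.le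
              _ = G / ζ * Λ * (ζ * u z) := by field_simp
              _ ≤ G / ζ * Λ * (g z * u z) := by
                  have := (hupos z).le
                  gcongr
          · intro y hy z hz
            simp only [Pi.mul_apply]
            rw [mul_div_mul_left _ _ (hgpos y).ne', mul_div_mul_left _ _ (hgpos z).ne']
            exact hD _ _ e y hy z hz)
      rw [el]
      refine (hres.trans (add_le_add (hmut.trans (add_le_add ih le_rfl)) le_rfl)).trans
        (le_of_eq ?_)
      have hb := momentConst_pos p
      have hDj := hD0 _ _ e
      have hDs : 0 ≤ ∑ i ∈ Finset.range (m + 1), D (n - i) :=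
        Finset.sum_nonneg fun i hi => hD0 i (n - i) (by simp at hi; omega)
      rw [← ENNReal.ofReal_add (by positivity) (by positivity),
        ← ENNReal.ofReal_add (by positivity) (by positivity), Finset.sum_range_succ _ (m + 1),
        show n - (m + 1) = j by omega]
      congr 1
      ring
  have := main n 0 (by simp)
  have hrefl : ∑ i ∈ Finset.range (n + 1), D (n - i) = ∑ i ∈ Finset.range (n + 1), D i :=
    Finset.sum_range_reflect D (n + 1)
  rw [hrefl] at this
  refine le_trans (le_of_eq ?_) this
  refine eLpNorm_congr_norm_ae (ae_of_all _ fun x => ?_)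
  rw [norm_sub_rev, integral_empirical x hf.1]
  simp [bwd, ha]

end Confined

end SSM

/-! ### Total variation distance and one-sided domination. -/

section TotalVariation

variable {E : Type*} [MeasurableSpace E]

lemma bddAbove_tvDist (μ η : Measure E) [IsProbabilityMeasure μ] [IsProbabilityMeasure η] :
    BddAbove (Set.range fun f : {f : E → ℝ // IsTest f} =>
      (1 / 2 : ℝ) * |∫ x, f.1 x ∂μ - ∫ x, f.1 x ∂η|) := by
  refine ⟨1, ?_⟩
  rintro _ ⟨f, rfl⟩
  have h1 := abs_integral_le_of_abs_le (μ := μ) f.2.2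
  have h2 := abs_integral_le_of_abs_le (μ := η) f.2.2
  have := abs_sub (∫ x, f.1 x ∂μ) (∫ x, f.1 x ∂η)
  simp only
  linarith

lemma abs_integral_sub_le_tvDist (μ η : Measure E) [IsProbabilityMeasure μ]
    [IsProbabilityMeasure η] {f : E → ℝ} (hf : IsTest f) :
    |∫ x, f x ∂μ - ∫ x, f x ∂η| ≤ 2 * tvDist μ η := by
  have := le_ciSup (bddAbove_tvDist μ η) ⟨f, hf⟩
  simp only at this
  rw [tvDist]
  linarith

lemma tvDist_le {μ η : Measure E} {b : ℝ}
    (h : ∀ f : E → ℝ, IsTest f → |∫ x, f x ∂μ - ∫ x, f x ∂η| ≤ 2 * b) : tvDist μ η ≤ b := by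
  have : Nonempty {f : E → ℝ // IsTest f} := ⟨fun _ => 0, measurable_const, by simp⟩
  refine ciSup_le fun f => ?_
  have := h f.1 f.2
  linarith

lemma tvDist_le_one (μ η : Measure E) [IsProbabilityMeasure μ] [IsProbabilityMeasure η] :
    tvDist μ η ≤ 1 := by
  refine tvDist_le fun f hf => ?_
  have h1 := abs_integral_le_of_abs_le (μ := μ) hf.2
  have h2 := abs_integral_le_of_abs_le (μ := η) hf.2
  have := abs_sub (∫ x, f x ∂μ) (∫ x, f x ∂η)
  linarith

/-- Domination on one side suffices, since both measures have mass one: integrate the nonnegative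
functions `B + f` and `B - f`. -/
lemma abs_integral_sub_le_of_le_smul {μ η : Measure E} [IsProbabilityMeasure μ]
    [IsProbabilityMeasure η] {c : ℝ} (hc : 1 ≤ c) (h : μ ≤ ENNReal.ofReal c • η) {f : E → ℝ}
    (hf : Measurable f) {B : ℝ} (hB : ∀ x, |f x| ≤ B) :
    |∫ x, f x ∂μ - ∫ x, f x ∂η| ≤ 2 * B * (c - 1) := by
  have hbm : IsBddMeas f := ⟨hf, B, hB⟩
  have key : ∀ s : ℝ, |s| = 1 → s * (∫ x, f x ∂μ - ∫ x, f x ∂η) ≤ 2 * B * (c - 1) := by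
    intro s hs
    have hb : ∀ x, |s * f x| ≤ B := fun x => by rw [abs_mul, hs, one_mul]; exact hB x
    have hi : ∀ (ν : Measure E) [IsProbabilityMeasure ν],
        ∫ x, (B + s * f x) ∂ν = B + s * ∫ x, f x ∂ν := by
      intro ν _
      rw [integral_add (integrable_const _) ((hbm.integrable ν).const_mul s), integral_const_mul]
      simp
    have h1 : ∫ x, (B + s * f x) ∂μ ≤ ∫ x, (B + s * f x) ∂(ENNReal.ofReal c • η) := by
      refine integral_mono_measure h (ae_of_all _ fun x => ?_) ?_
      · have := neg_le_of_abs_le (hb x)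
        simp only [Pi.zero_apply]
        linarith
      · exact (((integrable_const _).add ((hbm.integrable η).const_mul s))).smul_measure
          ENNReal.ofReal_ne_top
    rw [integral_smul_measure, ENNReal.toReal_ofReal (by linarith), hi, hi, smul_eq_mul] at h1
    have h2 := abs_integral_le_of_abs_le (μ := η) hb
    rw [integral_const_mul] at h2
    nlinarith [le_abs_self (s * ∫ x, f x ∂η)]
  rw [abs_le]
  have h1 := key 1 (by simp)
  have h2 := key (-1) (by simp)
  constructor <;> linarith

end TotalVariation

/-! ### Consequences of stability: sampling error and bias. -/

namespace SSM

variable {E : Type*} [MeasurableSpace E] {S T : SSM E} {M : ℕ∞} {A : ℕ → Set E} {ζ G : ℝ}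
  {r : ℕ → ℝ}

lemma Stable.nonneg (h : S.Stable M r) (j : ℕ) : 0 ≤ r j :=
  h.anti.le_of_tendsto h.summable.tendsto_atTop_zero j

/-- Translates forgetting of the starting point into small oscillation of the normalized backward
functions. -/
lemma Confined.puIter_dirac (hS : S.Confined M A ζ G) {f : E → ℝ} (hf : IsBddMeas f)
    {m j : ℕ} (hm : ((m + j : ℕ) : ℕ∞) ≤ M) (x : E) :
    ∫ y, f y ∂(S.puIter m j (Measure.dirac x)) = S.bwd f m j x / S.bwd (fun _ => 1) m j x := by
  rw [hS.integral_puIter hf j m hm,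
    integral_dirac' _ _ (hS.isBddMeas_bwd hf j m hm).1.stronglyMeasurable,
    integral_dirac' _ _ (hS.isBddMeas_bwd (isBddMeas_const 1) j m hm).1.stronglyMeasurable]

lemma Stable.abs_integral_puIter_sub_le (h : S.Stable M r) (hS : S.Confined M A ζ G)
    {m j : ℕ} (hm : ((m + j : ℕ) : ℕ∞) ≤ M) (μ η : Measure E) [hμ : IsProbabilityMeasure μ]
    [hη : IsProbabilityMeasure η] {f : E → ℝ} (hf : IsTest f) :
    |∫ y, f y ∂(S.puIter m j μ) - ∫ y, f y ∂(S.puIter m j η)| ≤ 2 * (r j * tvDist μ η) := by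
  have := hS.isProbabilityMeasure_puIter μ m j hm
  have := hS.isProbabilityMeasure_puIter η m j hm
  have := h.contract m j hm μ η hμ hη
  linarith [abs_integral_sub_le_tvDist (S.puIter m j μ) (S.puIter m j η) hf]

lemma Stable.abs_bwd_div_sub_le (h : S.Stable M r) (hS : S.Confined M A ζ G) {m j : ℕ}
    (hm : ((m + j : ℕ) : ℕ∞) ≤ M) {f : E → ℝ} (hf : IsTest f) (x y : E) :
    |S.bwd f m j x / S.bwd (fun _ => 1) m j x - S.bwd f m j y / S.bwd (fun _ => 1) m j y|
      ≤ 2 * r j := by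
  rw [← hS.puIter_dirac hf.isBddMeas hm, ← hS.puIter_dirac hf.isBddMeas hm]
  refine (h.abs_integral_puIter_sub_le hS hm _ _ hf).trans ?_
  have := mul_le_mul_of_nonneg_left (tvDist_le_one (Measure.dirac x) (Measure.dirac y))
    (h.nonneg j)
  linarith

lemma Confined.le_step_one (hS : S.Confined M A ζ G) {n : ℕ} (hn : n ∈ obsTimes M) (x : E) :
    ζ ≤ S.step n (fun _ => 1) x := by
  have := hS.kernel n hn
  calc ζ = ∫ _, ζ ∂(S.kernel n x) := by simp
    _ ≤ _ := integral_mono (integrable_const _)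
      (((hS.isBddMeas_lik hn).mul (isBddMeas_const 1)).integrable _) fun y => by
        simpa using hS.le_lik n hn y

lemma Confined.abs_step_le (hS : S.Confined M A ζ G) {n : ℕ} (hn : n ∈ obsTimes M) {h : E → ℝ}
    (hh : ∀ x, |h x| ≤ 1) (x : E) : |S.step n h x| ≤ G := by
  have := hS.kernel n hn
  refine abs_integral_le_of_abs_le fun y => ?_
  rw [abs_mul, abs_of_pos (hS.lik_pos hn y)]
  calc _ ≤ G * 1 := mul_le_mul (hS.lik_le n hn y) (hh y) (abs_nonneg _)
        (hS.zeta_pos.le.trans hS.zeta_le)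
    _ = G := mul_one G

/-- Stability bounds the ratios of the total masses, through a product of one-step ratios. -/
lemma Stable.bwd_one_le (h : S.Stable M r) (hS : S.Confined M A ζ G) {m : ℕ} (x y : E) :
    ∀ {j : ℕ}, ((m + j : ℕ) : ℕ∞) ≤ M → S.bwd (fun _ => 1) m j x
      ≤ (∏ i ∈ Finset.range j, (1 + 2 * G / ζ * r i)) * S.bwd (fun _ => 1) m j y
  | 0, _ => by simp [bwd]
  | j + 1, hm => by
      have hmj : ((m + j : ℕ) : ℕ∞) ≤ M :=
        le_trans (by exact_mod_cast (by omega : m + j ≤ m + (j + 1))) hm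
      have hn : m + j + 1 ∈ obsTimes M := ⟨by omega, hm⟩
      have ih := h.bwd_one_le hS x y hmj
      have h1 := isBddMeas_const (E := E) 1
      have hζ := hS.zeta_pos
      have hG : 0 < G := hζ.trans_le hS.zeta_le
      set q := S.step (m + j + 1) (fun _ => 1) with hq
      have hqb : IsBddMeas q := hS.isBddMeas_step hn h1
      have hu : ∀ z, 0 < S.bwd (fun _ => 1) m j z := hS.bwd_pos h1 (fun _ => one_pos) j m hmj
      have hqt : IsTest fun z => G⁻¹ * q z := by
        refine ⟨hqb.1.const_mul _, fun z => ?_⟩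
        rw [abs_mul, abs_of_pos (inv_pos.mpr hG), inv_mul_le_iff₀ hG, mul_one]
        exact hS.abs_step_le hn (by simp) z
      -- The last mass factor is the mean of `q = K(g)` under the filter started from `δ_z`. Since
      -- `ζ ≤ q ≤ G` and this filter forgets `z` at rate `r j`, changing `z` changes the factor by a
      -- ratio of at most `1 + 2 (G/ζ) r j`.
      have hfac : ∀ z, S.bwd (fun _ => 1) m (j + 1) z
          = S.bwd (fun _ => 1) m j z * ∫ w, q w ∂(S.puIter m j (Measure.dirac z)) := by
        intro z
        rw [bwd_succ_right, hS.puIter_dirac hqb hmj, mul_div_cancel₀ _ (hu z).ne']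
      have hdiff := h.abs_integral_puIter_sub_le hS hmj (Measure.dirac x) (Measure.dirac y) hqt
      rw [integral_const_mul, integral_const_mul, ← mul_sub, abs_mul,
        abs_of_pos (inv_pos.mpr hG), inv_mul_le_iff₀ hG] at hdiff
      have htv := mul_le_mul_of_nonneg_left (tvDist_le_one (Measure.dirac x) (Measure.dirac y))
        (h.nonneg j)
      have hlow : ∀ z, ζ ≤ ∫ w, q w ∂(S.puIter m j (Measure.dirac z)) := by
        intro z
        have := hS.isProbabilityMeasure_puIter (Measure.dirac z) m j hmj
        calc ζ = ∫ _, ζ ∂(S.puIter m j (Measure.dirac z)) := by simp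
          _ ≤ _ := integral_mono (integrable_const _) (hqb.integrable _) (hS.le_step_one hn)
      set a := ∫ w, q w ∂(S.puIter m j (Measure.dirac x))
      set b := ∫ w, q w ∂(S.puIter m j (Measure.dirac y))
      have hab : a ≤ (1 + 2 * G / ζ * r j) * b := by
        have h2 : a - b ≤ 2 * G * r j := by
          have := le_abs_self (a - b)
          nlinarith
        have h3 : 2 * G * r j ≤ 2 * G / ζ * r j * b := by
          have := h.nonneg j
          calc 2 * G * r j = 2 * G / ζ * r j * ζ := by field_simp
            _ ≤ _ := mul_le_mul_of_nonneg_left (hlow y) (by positivity)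
        linarith
      have hP : 0 ≤ ∏ i ∈ Finset.range j, (1 + 2 * G / ζ * r i) :=
        Finset.prod_nonneg fun i _ => by have := h.nonneg i; positivity
      rw [hfac, hfac, Finset.prod_range_succ]
      calc _ ≤ ((∏ i ∈ Finset.range j, (1 + 2 * G / ζ * r i)) * S.bwd (fun _ => 1) m j y) *
            ((1 + 2 * G / ζ * r j) * b) :=
            mul_le_mul ih hab (hζ.le.trans (hlow x)) (mul_nonneg hP (hu y).le)
        _ = _ := by ring

lemma Stable.sum_le (h : S.Stable M r) (s : Finset ℕ) : ∑ i ∈ s, r i ≤ ∑' i, r i :=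
  h.summable.sum_le_tsum _ fun i _ => h.nonneg i

/-- Time-uniform `L^p` error of the bootstrap particle filter run on a stable model. -/
lemma Stable.pfError_le (h : S.Stable M r) (hS : S.Confined M A ζ G) {N : ℕ} (hN : 1 ≤ N) {n : ℕ}
    (hn : (n : ℕ∞) ≤ M) {f : E → ℝ} (hf : IsTest f) {p : ℝ} (hp : 1 ≤ p) :
    S.pfError (S.filter n) N n p f ≤ ENNReal.ofReal (momentConst p * (G / ζ + 1) *
      Real.exp (2 * G / ζ * ∑' i, r i) * (2 * ∑' i, r i) / √N) := by
  have hζ := hS.zeta_pos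
  have hG : 0 < G := hζ.trans_le hS.zeta_le
  have hΛ : ∀ m j, m + j = n → ∀ x ∈ A m, ∀ y ∈ A m, S.bwd (fun _ => 1) m j x
      ≤ Real.exp (2 * G / ζ * ∑' i, r i) * S.bwd (fun _ => 1) m j y := by
    intro m j e x _ y _
    have hm : ((m + j : ℕ) : ℕ∞) ≤ M := by rwa [e]
    refine (h.bwd_one_le hS x y hm).trans ?_
    refine mul_le_mul_of_nonneg_right ?_
      (hS.bwd_pos (isBddMeas_const 1) (fun _ => one_pos) j m hm y).le
    calc ∏ i ∈ Finset.range j, (1 + 2 * G / ζ * r i)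
        ≤ ∏ i ∈ Finset.range j, Real.exp (2 * G / ζ * r i) := by
          refine Finset.prod_le_prod (fun i _ => ?_) fun i _ => ?_
          · have := h.nonneg i; positivity
          · linarith [Real.add_one_le_exp (2 * G / ζ * r i)]
      _ = Real.exp (2 * G / ζ * ∑ i ∈ Finset.range j, r i) := by
          rw [← Real.exp_sum, Finset.mul_sum]
      _ ≤ _ := by
          have := h.sum_le (Finset.range j)
          gcongr
  have hD : ∀ m j, m + j = n → ∀ x ∈ A m, ∀ y ∈ A m,
      S.bwd f m j x / S.bwd (fun _ => 1) m j x - S.bwd f m j y / S.bwd (fun _ => 1) m j y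
        ≤ 2 * r j := fun m j e x _ y _ =>
    (le_abs_self _).trans (h.abs_bwd_div_sub_le hS (by rwa [e]) hf x y)
  refine (hS.pfError_le hN hn hf.isBddMeas (D := fun j => 2 * r j) hΛ hD hp).trans
    (ENNReal.ofReal_le_ofReal ?_)
  rw [← Finset.mul_sum]
  have := h.sum_le (Finset.range (n + 1))
  have := momentConst_pos p
  gcongr

/-- A model whose prior and kernels are dominated, on the sets `A`, by `c` times those of a stable
model has a filter close to the filter of the stable model, uniformly in time. -/
lemma Stable.abs_filter_sub_le (h : S.Stable M r) {A' : ℕ → Set E} (hS : S.Confined M A' ζ G)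
    (hT : T.Confined M A ζ G) (hlik : T.lik = S.lik) {c : ℝ} (hc : 1 ≤ c)
    (hinit : T.init ≤ ENNReal.ofReal c • S.init)
    (hker : ∀ n ∈ obsTimes M, ∀ x ∈ A (n - 1),
      T.kernel n x ≤ ENNReal.ofReal c • S.kernel n x)
    {n : ℕ} (hn : (n : ℕ∞) ≤ M) {f : E → ℝ} (hf : IsTest f) :
    |∫ x, f x ∂(S.filter n) - ∫ x, f x ∂(T.filter n)| ≤ 4 * G / ζ * (∑' i, r i) * (c - 1) := by
  have hζ := hS.zeta_pos
  have hG : 0 < G := hζ.trans_le hS.zeta_le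
  have hc0 : 0 ≤ c - 1 := by linarith
  have hSi := hS.init
  have hTi := hT.init
  have h1 := isBddMeas_const (E := E) 1
  -- The cost of one swap: numerator and denominator of the update each move by at most `2 G (c -
  -- 1)`, the denominator is at least `ζ`, and total variation carries a factor `1/2`.
  set δ := 2 * G / ζ * (c - 1) with hδ
  have hδ0 : 0 ≤ δ := by positivity
  have htv0 : tvDist T.init S.init ≤ δ := by
    refine tvDist_le fun f hf => (abs_integral_sub_le_of_le_smul hc hinit hf.1 hf.2).trans ?_
    have : 1 ≤ G / ζ := by rw [le_div_iff₀ hζ, one_mul]; exact hS.zeta_le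
    rw [hδ, mul_div_assoc]
    nlinarith [mul_nonneg (by linarith : 0 ≤ G / ζ - 1) hc0]
  have htv : ∀ m, ((m + 1 : ℕ) : ℕ∞) ≤ M →
      tvDist (T.pu (m + 1) (T.filter m)) (S.pu (m + 1) (T.filter m)) ≤ δ := by
    intro m hm
    have hm1 : m + 1 ∈ obsTimes M := ⟨by omega, hm⟩
    have hmM : (m : ℕ∞) ≤ M := le_trans (by exact_mod_cast Nat.le_succ m) hm
    have hp := hT.isProbabilityMeasure_filter hmM
    have := hS.isProbabilityMeasure_pu hm1 (T.filter m)
    have hkS := hS.kernel _ hm1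
    have hkT := hT.kernel _ hm1
    have hstep : ∀ {h : E → ℝ}, IsTest h →
        |∫ x, T.step (m + 1) h x ∂(T.filter m) - ∫ x, S.step (m + 1) h x ∂(T.filter m)|
          ≤ 2 * G * (c - 1) := by
      intro h hh
      rw [← integral_sub ((hT.isBddMeas_step hm1 hh.isBddMeas).integrable _)
        ((hS.isBddMeas_step hm1 hh.isBddMeas).integrable _)]
      have := norm_integral_le_of_norm_le_const (μ := T.filter m)
        (f := fun x => T.step (m + 1) h x - S.step (m + 1) h x) (C := 2 * G * (c - 1)) (by
          -- The kernels are comparable only on `A m`, and the filter of `T` is carried by it.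
          filter_upwards [hT.ae_filter_mem hmM] with x hx
          simp only [step, hlik]
          refine abs_integral_sub_le_of_le_smul hc (hker _ hm1 x (by simpa using hx))
            ((hS.lik _ hm1).mul hh.1) fun y => ?_
          rw [Pi.mul_apply, abs_mul, abs_of_pos (hS.lik_pos hm1 y)]
          calc _ ≤ G * 1 := mul_le_mul (hS.lik_le _ hm1 y) (hh.2 y) (abs_nonneg _) hG.le
            _ = G := mul_one G)
      simpa using this
    refine tvDist_le fun f hf => ?_
    have ha := hstep hf
    have hb := hstep (h := fun _ => 1) ⟨measurable_const, by simp⟩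
    have hq := abs_integral_le_of_abs_le (μ := S.pu (m + 1) (T.filter m)) hf.2
    have hbT : ζ ≤ ∫ x, T.step (m + 1) (fun _ => 1) x ∂(T.filter m) := by
      calc ζ = ∫ _, ζ ∂(T.filter m) := by simp
        _ ≤ _ := integral_mono (integrable_const _) ((hT.isBddMeas_step hm1 h1).integrable _)
          (hT.le_step_one hm1)
    have hbS : 0 < ∫ x, S.step (m + 1) (fun _ => 1) x ∂(T.filter m) :=
      IsBddMeas.integral_pos _ (hS.isBddMeas_step hm1 h1) (hS.step_pos hm1 h1 fun _ => one_pos)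
    rw [hS.integral_pu hm1 _ hf.isBddMeas] at hq ⊢
    rw [hT.integral_pu hm1 _ hf.isBddMeas]
    set a := ∫ x, T.step (m + 1) f x ∂(T.filter m)
    set a' := ∫ x, S.step (m + 1) f x ∂(T.filter m)
    set b := ∫ x, T.step (m + 1) (fun _ => 1) x ∂(T.filter m)
    set b' := ∫ x, S.step (m + 1) (fun _ => 1) x ∂(T.filter m)
    have hb0 : 0 < b := hζ.trans_le hbT
    -- Written so that the second quotient appears only as a mean of a test function, bounded by
    -- one.
    have he : a / b - a' / b' = ((a - a') - a' / b' * (b - b')) / b := by field_simp; ring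
    rw [he, abs_div, abs_of_pos hb0, div_le_iff₀ hb0]
    calc |a - a' - a' / b' * (b - b')| ≤ |a - a'| + |a' / b'| * |b - b'| := by
          rw [← abs_mul]; exact abs_sub _ _
      _ ≤ 2 * G * (c - 1) + 1 * (2 * G * (c - 1)) := by gcongr
      _ = 2 * δ * ζ := by rw [hδ]; field_simp; ring
      _ ≤ 2 * δ * b := by gcongr
  -- The interpolation runs `T` up to time `m` and `S` afterwards; raising `m` by one swaps a single
  -- update, whose effect is contracted by `r (n - (m + 1))`.
  have main : ∀ m j, m + j = n →
      |∫ x, f x ∂(S.puIter m j (T.filter m)) - ∫ x, f x ∂(S.filter n)|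
        ≤ ∑ i ∈ Finset.range (m + 1), 2 * (r (n - i) * δ) := by
    intro m
    induction m with
    | zero =>
      intro j e
      obtain rfl : j = n := by omega
      have h2 := h.abs_integral_puIter_sub_le hS (m := 0) (j := j) (by simpa using hn)
        T.init S.init hf
      rw [filter_eq_puIter S]
      refine h2.trans ?_
      have := h.nonneg j
      simp only [zero_add, Finset.sum_range_one, Nat.sub_zero]
      gcongr
    | succ m ih =>
      intro j e
      have e' : m + (j + 1) = n := by omega
      have ih := ih (j + 1) e'
      have hm : ((m + 1 : ℕ) : ℕ∞) ≤ M := le_trans (by exact_mod_cast (by omega : m + 1 ≤ n)) hn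
      have hm1 : m + 1 ∈ obsTimes M := ⟨by omega, hm⟩
      have hmM : (m : ℕ∞) ≤ M := le_trans (by exact_mod_cast Nat.le_succ m) hm
      have hp := hT.isProbabilityMeasure_filter hmM
      have := hS.isProbabilityMeasure_pu hm1 (T.filter m)
      have := hT.isProbabilityMeasure_pu hm1 (T.filter m)
      have h2 := h.abs_integral_puIter_sub_le hS (m := m + 1) (j := j) (by rwa [e])
        (T.pu (m + 1) (T.filter m)) (S.pu (m + 1) (T.filter m)) hf
      rw [← puIter_succ_left] at h2
      rw [Finset.sum_range_succ, show n - (m + 1) = j by omega]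
      have h3 := mul_le_mul_of_nonneg_left (htv m hm) (h.nonneg j)
      refine (abs_sub_le _ (∫ x, f x ∂(S.puIter m (j + 1) (T.filter m))) _).trans ?_
      rw [filter]
      linarith
  have := main n 0 (by simp)
  have hrefl : ∑ i ∈ Finset.range (n + 1), 2 * (r (n - i) * δ)
      = ∑ i ∈ Finset.range (n + 1), 2 * (r i * δ) :=
    Finset.sum_range_reflect (fun i => 2 * (r i * δ)) (n + 1)
  rw [hrefl, ← Finset.mul_sum, ← Finset.sum_mul, puIter, abs_sub_comm] at this
  refine this.trans ?_
  calc 2 * ((∑ i ∈ Finset.range (n + 1), r i) * δ) ≤ 2 * ((∑' i, r i) * δ) := by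
        gcongr
        exact h.sum_le _
    _ = _ := by rw [hδ]; ring

/-! ### Sampling error under mixing. -/

section Mixing

variable {E : Type*} [MeasurableSpace E] {T : SSM E} {M : ℕ∞} {A : ℕ → Set E} {ζ G γ : ℝ}

/-- Only the first transition matters: two comparable measures integrate the same positive function.
-/
lemma Confined.bwd_ratio_of_mixing (hT : T.Confined M A ζ G) (hγ : 0 < γ) (hγ1 : γ ≤ 1)
    (hmix : ∀ n ∈ obsTimes M, ∀ x ∈ A (n - 1), ∀ y ∈ A (n - 1),
      T.kernel n x ≤ ENNReal.ofReal γ⁻¹ • T.kernel n y) {m : ℕ} :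
    ∀ {j : ℕ}, ((m + j : ℕ) : ℕ∞) ≤ M → ∀ x ∈ A m, ∀ y ∈ A m,
      T.bwd (fun _ => 1) m j x ≤ γ⁻¹ * T.bwd (fun _ => 1) m j y
  | 0, _, x, _, y, _ => by simpa [bwd] using (one_le_inv₀ hγ).mpr hγ1
  | j + 1, hm, x, hx, y, hy => by
      have hm' : ((m + 1 + j : ℕ) : ℕ∞) ≤ M := by rwa [add_right_comm, add_assoc]
      have hn := mem_obsTimes_succ hm
      have := hT.kernel _ hn
      have h1 := isBddMeas_const (E := E) 1
      have hb := (hT.isBddMeas_lik hn).mul (hT.isBddMeas_bwd h1 j _ hm')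
      have h2 := integral_mono_measure (hmix _ hn x (by simpa using hx) y (by simpa using hy))
        (ae_of_all _ fun z => (mul_pos (hT.lik_pos hn z)
          (hT.bwd_pos h1 (fun _ => one_pos) j _ hm' z)).le)
        ((hb.integrable _).smul_measure ENNReal.ofReal_ne_top)
      rwa [integral_smul_measure, ENNReal.toReal_ofReal (inv_pos.mpr hγ).le] at h2

/-- Doeblin's argument. With `a` the infimum of `v / u` one step later, the excess of the ratio over
`a` at `y` is at least `γ²` times the excess at `x`: one `γ` from comparing numerators, one from
denominators. The excess at `x` is at most the previous oscillation, which therefore shrinks by `1 -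
γ²`. -/
lemma Confined.bwd_osc_of_mixing (hT : T.Confined M A ζ G) (hγ : 0 < γ) (hγ1 : γ ≤ 1)
    (hmix : ∀ n ∈ obsTimes M, ∀ x ∈ A (n - 1), ∀ y ∈ A (n - 1),
      T.kernel n x ≤ ENNReal.ofReal γ⁻¹ • T.kernel n y) {f : E → ℝ} (hf : IsTest f) :
    ∀ {j m : ℕ}, ((m + j : ℕ) : ℕ∞) ≤ M → ∀ x ∈ A m, ∀ y ∈ A m,
      T.bwd f m j x / T.bwd (fun _ => 1) m j x - T.bwd f m j y / T.bwd (fun _ => 1) m j y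
        ≤ 2 * (1 - γ ^ 2) ^ j
  | 0, m, _, x, _, y, _ => by
      have h1 := abs_le.mp (hf.2 x)
      have h2 := abs_le.mp (hf.2 y)
      simp only [bwd, div_one, pow_zero]
      linarith
  | j + 1, m, hm, x, hx, y, hy => by
      have hm' : ((m + 1 + j : ℕ) : ℕ∞) ≤ M := by rwa [add_right_comm, add_assoc]
      have hn := mem_obsTimes_succ hm
      have hk := hT.kernel _ hn
      have h1 := isBddMeas_const (E := E) 1
      have ih := Confined.bwd_osc_of_mixing hT hγ hγ1 hmix hf (m := m + 1) (j := j) hm'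
      have hgu := (hT.isBddMeas_lik hn).mul (hT.isBddMeas_bwd h1 j _ hm')
      have hgv := (hT.isBddMeas_lik hn).mul (hT.isBddMeas_bwd hf.isBddMeas j _ hm')
      have hupos := hT.bwd_pos h1 (fun _ => one_pos) j _ hm'
      have hx' : x ∈ A (m + 1 - 1) := by simpa using hx
      have hy' : y ∈ A (m + 1 - 1) := by simpa using hy
      simp only [bwd, step]
      set u := T.bwd (fun _ => 1) (m + 1) j
      set v := T.bwd f (m + 1) j
      set g := T.lik (m + 1)
      have hg : ∀ z, 0 < g z := hT.lik_pos hn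
      set D := 2 * (1 - γ ^ 2) ^ j
      have hguy : ∀ z, 0 < ∫ w, g w * u w ∂(T.kernel (m + 1) z) := fun z =>
        IsBddMeas.integral_pos _ hgu fun w => mul_pos (hg w) (hupos w)
      obtain ⟨w₀, hw₀⟩ := (hT.kernel_mem _ hn x).exists
      obtain ⟨a, ha, haD⟩ : ∃ a : ℝ, (∀ w ∈ A (m + 1), a ≤ v w / u w) ∧
          ∀ w ∈ A (m + 1), v w / u w ≤ a + D := by
        have hb : BddBelow ((fun w => v w / u w) '' A (m + 1)) := by
          refine ⟨v w₀ / u w₀ - D, ?_⟩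
          rintro _ ⟨w, hw, rfl⟩
          have := ih w₀ hw₀ w hw
          simp only
          linarith
        refine ⟨sInf ((fun w => v w / u w) '' A (m + 1)), fun w hw => csInf_le hb ⟨w, hw, rfl⟩,
          fun w hw => ?_⟩
        have : v w / u w - D ≤ sInf ((fun w => v w / u w) '' A (m + 1)) := by
          refine le_csInf ⟨_, w₀, hw₀, rfl⟩ ?_
          rintro _ ⟨z, hz, rfl⟩
          have := ih w hw z hz
          simp only
          linarith
        linarith
      have hlin : ∀ z, ∫ w, (g w * v w - a * (g w * u w)) ∂(T.kernel (m + 1) z)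
          = ∫ w, g w * v w ∂(T.kernel (m + 1) z) - a * ∫ w, g w * u w ∂(T.kernel (m + 1) z) :=
        fun z => by rw [integral_sub (hgv.integrable _) ((hgu.integrable _).const_mul a),
          integral_const_mul]
      have hnum : ∫ w, (g w * v w - a * (g w * u w)) ∂(T.kernel (m + 1) x)
          ≤ γ⁻¹ * ∫ w, (g w * v w - a * (g w * u w)) ∂(T.kernel (m + 1) y) := by
        have h2 := integral_mono_measure (f := fun w => g w * v w - a * (g w * u w))
          (hmix _ hn x hx' y hy') (by
            refine Measure.ae_smul_measure ((hT.kernel_mem _ hn y).mono fun w hw => ?_) _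
            have h3 := ha w hw
            rw [le_div_iff₀ (hupos w)] at h3
            have := mul_le_mul_of_nonneg_left h3 (hg w).le
            simp only [Pi.zero_apply]
            linarith)
          (((hgv.integrable _).sub ((hgu.integrable _).const_mul a)).smul_measure
            ENNReal.ofReal_ne_top)
        rwa [integral_smul_measure, ENNReal.toReal_ofReal (inv_pos.mpr hγ).le] at h2
      have hden : ∫ w, g w * u w ∂(T.kernel (m + 1) y)
          ≤ γ⁻¹ * ∫ w, g w * u w ∂(T.kernel (m + 1) x) := by
        have h2 := integral_mono_measure (hmix _ hn y hy' x hx')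
          (ae_of_all _ fun w => (mul_pos (hg w) (hupos w)).le)
          ((hgu.integrable _).smul_measure ENNReal.ofReal_ne_top)
        rwa [integral_smul_measure, ENNReal.toReal_ofReal (inv_pos.mpr hγ).le] at h2
      have hup : ∫ w, g w * v w ∂(T.kernel (m + 1) x)
          ≤ (a + D) * ∫ w, g w * u w ∂(T.kernel (m + 1) x) := by
        rw [← integral_const_mul]
        refine integral_mono_ae (hgv.integrable _) ((hgu.integrable _).const_mul _)
          ((hT.kernel_mem _ hn x).mono fun w hw => ?_)
        have h3 := haD w hw
        rw [div_le_iff₀ (hupos w)] at h3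
        have := mul_le_mul_of_nonneg_left h3 (hg w).le
        simp only
        linarith
      rw [hlin, hlin] at hnum
      have hX := hguy x
      have hY := hguy y
      set vx := ∫ w, g w * v w ∂(T.kernel (m + 1) x)
      set ux := ∫ w, g w * u w ∂(T.kernel (m + 1) x)
      set vy := ∫ w, g w * v w ∂(T.kernel (m + 1) y)
      set uy := ∫ w, g w * u w ∂(T.kernel (m + 1) y)
      have hp0 : 0 ≤ vx - a * ux := by
        rw [← hlin]
        refine integral_nonneg_of_ae ((hT.kernel_mem _ hn x).mono fun w hw => ?_)
        have h3 := ha w hw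
        rw [le_div_iff₀ (hupos w)] at h3
        have := mul_le_mul_of_nonneg_left h3 (hg w).le
        simp only [Pi.zero_apply]
        linarith
      have hx1 : vx / ux - a ≤ D := by
        rw [sub_le_iff_le_add, div_le_iff₀ hX]; linarith
      have hkey : γ ^ 2 * (vx / ux - a) ≤ vy / uy - a := by
        have e1 : vx / ux - a = (vx - a * ux) / ux := by field_simp
        have e2 : vy / uy - a = (vy - a * uy) / uy := by field_simp
        rw [inv_mul_eq_div, le_div_iff₀ hγ] at hnum hden
        rw [e1, e2, le_div_iff₀ hY, ← mul_div_assoc, div_mul_eq_mul_div, div_le_iff₀ hX]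
        calc γ ^ 2 * (vx - a * ux) * uy = ((vx - a * ux) * γ) * (uy * γ) := by ring
          _ ≤ (vy - a * uy) * ux := mul_le_mul hnum hden (by positivity)
              ((mul_nonneg hp0 hγ.le).trans hnum)
      have hγ2 : 0 ≤ 1 - γ ^ 2 := by nlinarith
      calc vx / ux - vy / uy ≤ (1 - γ ^ 2) * (vx / ux - a) := by linarith
        _ ≤ (1 - γ ^ 2) * D := by gcongr
        _ = _ := by simp only [D]; ring

/-- Time-uniform `L^p` error of the bootstrap particle filter run on a mixing model. -/
lemma Confined.pfError_le_of_mixing (hT : T.Confined M A ζ G) (hγ : 0 < γ) (hγ1 : γ ≤ 1)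
    (hmix : ∀ n ∈ obsTimes M, ∀ x ∈ A (n - 1), ∀ y ∈ A (n - 1),
      T.kernel n x ≤ ENNReal.ofReal γ⁻¹ • T.kernel n y) {N : ℕ} (hN : 1 ≤ N) {n : ℕ}
    (hn : (n : ℕ∞) ≤ M) {f : E → ℝ} (hf : IsTest f) {p : ℝ} (hp : 1 ≤ p) :
    T.pfError (T.filter n) N n p f ≤
      ENNReal.ofReal (4 * momentConst p * G / (ζ * γ ^ 3 * √N)) := by
  have hζ := hT.zeta_pos
  have hG : 0 < G := hζ.trans_le hT.zeta_le
  have hb := momentConst_pos p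
  have hN0 : 0 < √(N : ℝ) := Real.sqrt_pos.mpr (by exact_mod_cast hN)
  refine (hT.pfError_le hN hn hf.isBddMeas (Λ := γ⁻¹) (D := fun j => 2 * (1 - γ ^ 2) ^ j)
    (fun m j e => hT.bwd_ratio_of_mixing hγ hγ1 hmix (by rwa [e]))
    (fun m j e => hT.bwd_osc_of_mixing hγ hγ1 hmix hf (by rwa [e])) hp).trans
    (ENNReal.ofReal_le_ofReal ?_)
  have hγ2 : 0 ≤ 1 - γ ^ 2 := by nlinarith
  -- The geometric series contributes `γ^{-2}`, which with `Λ = γ^{-1}` makes `γ^{-3}`.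
  have hs : ∑ j ∈ Finset.range (n + 1), (1 - γ ^ 2) ^ j ≤ (γ ^ 2)⁻¹ := by
    have h1 := mul_neg_geom_sum (1 - γ ^ 2) (n + 1)
    have h2 : 0 ≤ (1 - γ ^ 2) ^ (n + 1) := by positivity
    rw [sub_sub_cancel] at h1
    rw [← one_div, le_div_iff₀ (by positivity)]
    linarith
  have hG1 : G / ζ + 1 ≤ 2 * (G / ζ) := by
    have : 1 ≤ G / ζ := by rw [le_div_iff₀ hζ, one_mul]; exact hT.zeta_le
    linarith
  rw [← Finset.mul_sum]
  calc _ ≤ momentConst p * (2 * (G / ζ)) * γ⁻¹ * (2 * (γ ^ 2)⁻¹) / √N := by gcongr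
    _ = _ := by field_simp; ring

end Mixing

/-! ### Domination of particle laws. -/

section Domination

variable {E : Type*} [MeasurableSpace E]

/-- An inequality of measures does not extend from a π-system. Instead, the product outer measure is
the largest one bounded by the products on boxes, so a test on boxes suffices. -/
lemma pi_le_smul_pi {N : ℕ} {μ η : Fin N → Measure E} [∀ i, IsProbabilityMeasure (μ i)]
    [∀ i, IsProbabilityMeasure (η i)] {c : ℝ≥0∞} (hc : c ≠ 0) (hc' : c ≠ ∞)
    (h : ∀ i, μ i ≤ c • η i) : Measure.pi μ ≤ c ^ N • Measure.pi η := by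
  have h0 : c ^ N ≠ 0 := pow_ne_zero _ hc
  have h1 : c ^ N ≠ ∞ := ENNReal.pow_ne_top hc'
  have key : ((c ^ N)⁻¹ • Measure.pi μ).toOuterMeasure
      ≤ OuterMeasure.pi fun i => (η i).toOuterMeasure := by
    rw [OuterMeasure.le_pi]
    intro s _
    change ((c ^ N)⁻¹ • Measure.pi μ) (Set.univ.pi s) ≤ ∏ i, η i (s i)
    rw [Measure.smul_apply, Measure.pi_pi, smul_eq_mul, ENNReal.inv_mul_le_iff h0 h1]
    calc ∏ i, μ i (s i) ≤ ∏ i, c * η i (s i) := Finset.prod_le_prod' fun i _ => h i (s i)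
      _ = _ := by rw [Finset.prod_mul_distrib]; simp
  refine Measure.le_iff.mpr fun s hs => ?_
  have h2 := key s
  have h3 : Measure.pi η s = OuterMeasure.pi (fun i => (η i).toOuterMeasure) s := by
    rw [Measure.pi, toMeasure_apply _ _ hs]
  rw [Measure.smul_apply, smul_eq_mul, ← ENNReal.inv_mul_le_iff h0 h1, h3]
  exact h2

/-- The kernels are compared only `μ`-almost everywhere, because a constrained kernel is dominated
only at states inside the constraints, where the constrained particles live. -/
lemma bind_le_smul_bind {α β : Type*} [MeasurableSpace α] [MeasurableSpace β] {μ μ' : Measure α}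
    {κ κ' : Kernel α β} {a b : ℝ≥0∞} (hμ : μ ≤ a • μ') (hκ : ∀ᵐ x ∂μ, κ x ≤ b • κ' x) :
    μ.bind κ ≤ (a * b) • μ'.bind κ' := by
  refine Measure.le_iff.mpr fun s hs => ?_
  rw [Measure.smul_apply, Measure.bind_apply hs κ.aemeasurable,
    Measure.bind_apply hs κ'.aemeasurable, smul_eq_mul]
  calc ∫⁻ x, κ x s ∂μ ≤ ∫⁻ x, b * κ' x s ∂μ :=
        lintegral_mono_ae (hκ.mono fun x hx => hx s)
    _ ≤ ∫⁻ x, b * κ' x s ∂(a • μ') := lintegral_mono' hμ le_rfl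
    _ = _ := by
        rw [lintegral_smul_measure, lintegral_const_mul _ (κ'.measurable_coe hs), smul_eq_mul,
          mul_assoc]

variable {S T : SSM E} {M : ℕ∞} {A A' : ℕ → Set E} {ζ G : ℝ}

lemma Confined.ae_particleLaw_mem (hT : T.Confined M A ζ G) {N : ℕ} (hN : 1 ≤ N) :
    ∀ {n : ℕ}, (n : ℕ∞) ≤ M → ∀ᵐ x ∂(T.particleLaw N n), ∀ i, x i ∈ A n
  | 0, _ => by
      have := hT.init
      exact ae_pi_forall_mem (fun _ => T.init) fun _ => hT.init_mem
  | n + 1, h => by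
      have hn : n + 1 ∈ obsTimes M := ⟨by omega, h⟩
      obtain ⟨hk, e⟩ := hT.particleLaw_succ hn hN
      have hm := measurableSet_forall_mem (N := N) (hT.measurableSet _ h)
      rw [e]
      refine Measure.ae_comp_of_ae_ae hm ?_
      have hb : ∀ᵐ x ∂((T.particleLaw N n).bind (mutateKernel (T.kernel (n + 1)) N)),
          ∀ i, x i ∈ A (n + 1) :=
        Measure.ae_comp_of_ae_ae hm (ae_of_all _ fun x =>
          ae_pi_forall_mem (fun i => T.kernel (n + 1) (x i)) fun i => hT.kernel_mem _ hn _)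
      filter_upwards [hb] with x hx
      have := isProbabilityMeasure_weighted (hT.lik_pos hn) hN x
      exact ae_pi_forall_mem (fun _ => weighted (T.lik (n + 1)) x)
        fun i => ae_weighted_mem (hT.measurableSet _ h) hx

/-- If the prior and the kernels of `T` are dominated, on the sets carrying `T`, by `c` times
those of `S`, then the particle laws of `T` are dominated by a power of `c` times those of `S`. -/
lemma Confined.particleLaw_le (hT : T.Confined M A ζ G) (hS : S.Confined M A' ζ G)
    (hlik : T.lik = S.lik) {c : ℝ≥0∞} (hc : c ≠ 0) (hc' : c ≠ ∞) (hinit : T.init ≤ c • S.init)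
    (hker : ∀ n ∈ obsTimes M, ∀ x ∈ A (n - 1), T.kernel n x ≤ c • S.kernel n x)
    {N : ℕ} (hN : 1 ≤ N) :
    ∀ {n : ℕ}, (n : ℕ∞) ≤ M → T.particleLaw N n ≤ (c ^ N) ^ (n + 1) • S.particleLaw N n
  | 0, _ => by
      have := hT.init
      have := hS.init
      rw [zero_add, pow_one]
      exact pi_le_smul_pi hc hc' fun _ => hinit
  | n + 1, h => by
      have hn : n + 1 ∈ obsTimes M := ⟨by omega, h⟩
      have hnM : (n : ℕ∞) ≤ M := le_trans (by exact_mod_cast Nat.le_succ n) h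
      have ih := hT.particleLaw_le hS hlik hc hc' hinit hker hN hnM
      obtain ⟨hkT, eT⟩ := hT.particleLaw_succ hn hN
      obtain ⟨hkS, eS⟩ := hS.particleLaw_succ hn hN
      have hb := bind_le_smul_bind (κ := mutateKernel (T.kernel (n + 1)) N)
        (κ' := mutateKernel (S.kernel (n + 1)) N) (b := c ^ N) ih
        ((hT.ae_particleLaw_mem hN hnM).mono fun x hx =>
          pi_le_smul_pi hc hc' fun i => hker _ hn _ (by simpa using hx i))
      have hr := bind_le_smul_bind (κ := resampleKernel (T.lik (n + 1)) (hT.lik _ hn)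
          (hT.lik_pos hn) hN) (κ' := resampleKernel (S.lik (n + 1)) (hS.lik _ hn)
          (hS.lik_pos hn) hN) (b := 1) hb (ae_of_all _ fun x => by
          rw [one_smul]
          change resample (T.lik (n + 1)) x ≤ resample (S.lik (n + 1)) x
          rw [hlik])
      rw [eT, eS, pow_succ]
      rwa [mul_one] at hr

lemma isBddMeas_rpow_error {N : ℕ} {f : E → ℝ} (hf : IsTest f) (a : ℝ) {p : ℝ} (hp : 0 ≤ p) :
    IsBddMeas fun x : Fin N → E => |a - (∑ i, f (x i)) / N| ^ p := by
  have hm : Measurable fun x : Fin N → E => ∑ i, f (x i) :=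
    Finset.measurable_sum _ fun i _ => hf.1.comp (measurable_pi_apply i)
  refine ⟨((measurable_const.sub (hm.div_const _)).abs).pow_const p, (|a| + 1) ^ p, fun x => ?_⟩
  rw [abs_of_nonneg (by positivity)]
  refine Real.rpow_le_rpow (abs_nonneg _) ((abs_sub _ _).trans ?_) hp
  gcongr
  rw [abs_div, Nat.abs_cast]
  refine div_le_one_of_le₀ ?_ (Nat.cast_nonneg _)
  calc |∑ i, f (x i)| ≤ ∑ i, |f (x i)| := Finset.abs_sum_le_sum_abs _ _
    _ ≤ ∑ _i : Fin N, 1 := Finset.sum_le_sum fun i _ => hf.2 _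
    _ = N := by simp

/-- Expresses the error through the integral of a bounded function, to which comparison of laws
applies. -/
lemma pfError_eq {N n : ℕ} [IsProbabilityMeasure (T.particleLaw N n)] {f : E → ℝ}
    (hf : IsTest f) (a : Measure E) {p : ℝ} (hp : 1 ≤ p) :
    T.pfError a N n p f = ENNReal.ofReal
      (∫ x, |∫ y, f y ∂a - (∑ i, f (x i)) / N| ^ p ∂(T.particleLaw N n)) ^ (1 / p) := by
  have hp0 : 0 < p := by linarith
  rw [pfError, eLpNorm_eq_lintegral_rpow_enorm_toReal (by simpa using hp0) ENNReal.ofReal_ne_top,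
    ENNReal.toReal_ofReal hp0.le, ofReal_integral_eq_lintegral_ofReal]
  · congr 1
    refine lintegral_congr fun x => ?_
    rw [integral_empirical x hf.1, Real.enorm_eq_ofReal_abs,
      ENNReal.ofReal_rpow_of_nonneg (abs_nonneg _) hp0.le]
  · exact (isBddMeas_rpow_error hf _ hp0.le).integrable _
  · exact ae_of_all _ fun x => by positivity

end Domination

/-! ### Changing the target measure, and convergence of the errors. -/

section Comparison

variable {E : Type*} [MeasurableSpace E] {S T : SSM E} {M : ℕ∞} {A : ℕ → Set E} {ζ G : ℝ}

lemma measurable_empirical_error {N : ℕ} {f : E → ℝ} (hf : IsTest f) (a : ℝ) :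
    Measurable fun x : Fin N → E => a - ∫ y, f y ∂(empirical x) := by
  simp only [integral_empirical _ hf.1]
  exact measurable_const.sub ((Finset.measurable_sum _ fun i _ =>
    hf.1.comp (measurable_pi_apply i)).div_const _)

lemma eLpNorm_const_eq {Ω : Type*} [MeasurableSpace Ω] (μ : Measure Ω) [IsProbabilityMeasure μ]
    (a : ℝ) {p : ℝ} (hp : 1 ≤ p) :
    eLpNorm (fun _ => a) (ENNReal.ofReal p) μ = ENNReal.ofReal |a| := by
  rw [eLpNorm_const _ (by simp; linarith) (IsProbabilityMeasure.ne_zero μ)]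
  simp [Real.enorm_eq_ofReal_abs]

lemma pfError_le_add {N n : ℕ} [IsProbabilityMeasure (T.particleLaw N n)] {f : E → ℝ}
    (hf : IsTest f) (π π' : Measure E) {p : ℝ} (hp : 1 ≤ p) :
    T.pfError π N n p f
      ≤ ENNReal.ofReal |∫ x, f x ∂π - ∫ x, f x ∂π'| + T.pfError π' N n p f := by
  have h : (fun x : Fin N → E => ∫ y, f y ∂π - ∫ y, f y ∂(empirical x))
      = (fun _ => ∫ x, f x ∂π - ∫ x, f x ∂π') +
        fun x : Fin N → E => ∫ y, f y ∂π' - ∫ y, f y ∂(empirical x) := by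
    ext x; simp
  rw [pfError, h]
  refine (eLpNorm_add_le measurable_const.aestronglyMeasurable
    (measurable_empirical_error hf _).aestronglyMeasurable (by simpa using hp)).trans ?_
  rw [eLpNorm_const_eq _ _ hp]
  rfl

lemma ofReal_abs_le_pfError_add {N n : ℕ} [IsProbabilityMeasure (T.particleLaw N n)] {f : E → ℝ}
    (hf : IsTest f) (π π' : Measure E) {p : ℝ} (hp : 1 ≤ p) :
    ENNReal.ofReal |∫ x, f x ∂π - ∫ x, f x ∂π'|
      ≤ T.pfError π N n p f + T.pfError π' N n p f := by
  rw [← eLpNorm_const_eq (T.particleLaw N n) _ hp]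
  have h : (fun _ : Fin N → E => ∫ x, f x ∂π - ∫ x, f x ∂π')
      = (fun x : Fin N → E => ∫ y, f y ∂π - ∫ y, f y ∂(empirical x)) -
        fun x : Fin N → E => ∫ y, f y ∂π' - ∫ y, f y ∂(empirical x) := by
    ext x; simp
  rw [h]
  exact eLpNorm_sub_le (measurable_empirical_error hf _).aestronglyMeasurable
    (measurable_empirical_error hf _).aestronglyMeasurable (by simpa using hp)

/-- Particle laws dominated by constants tending to `1` give convergence of the `L^p` errors. -/
lemma tendsto_pfError {T : ℕ → SSM E} {N n : ℕ} [IsProbabilityMeasure (S.particleLaw N n)]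
    (hT : ∀ l, IsProbabilityMeasure ((T l).particleLaw N n)) {c : ℕ → ℝ} (hc : ∀ l, 1 ≤ c l)
    (hc1 : Tendsto c atTop (𝓝 1))
    (hle : ∀ l, (T l).particleLaw N n ≤ ENNReal.ofReal (c l) • S.particleLaw N n)
    {f : E → ℝ} (hf : IsTest f) (π : Measure E) {p : ℝ} (hp : 1 ≤ p) :
    Tendsto (fun l => (T l).pfError π N n p f) atTop (𝓝 (S.pfError π N n p f)) := by
  simp only [pfError_eq hf π hp]
  refine (ENNReal.continuous_rpow_const.tendsto _).comp (ENNReal.tendsto_ofReal ?_)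
  obtain ⟨hm, B, hB⟩ := isBddMeas_rpow_error (N := N) hf (∫ y, f y ∂π) (by linarith : 0 ≤ p)
  rw [tendsto_iff_dist_tendsto_zero]
  refine squeeze_zero (fun _ => dist_nonneg)
    (fun l => abs_integral_sub_le_of_le_smul (hc l) (hle l) hm hB) ?_
  have := (hc1.sub_const 1).const_mul (2 * B)
  simpa using this

end Comparison

/-! ### Conditioning on a set. -/

section Conditioning

variable {E : Type*} [MeasurableSpace E]

lemma cond_le_smul {μ : Measure E} [IsProbabilityMeasure μ] {C : Set E} {ε : ℝ} (hε : 0 < ε)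
    (h : ε ≤ μ.real C) : ProbabilityTheory.cond μ C ≤ ENNReal.ofReal ε⁻¹ • μ := by
  have h1 : ENNReal.ofReal ε ≤ μ C := ENNReal.ofReal_le_of_le_toReal h
  have h2 : (μ C)⁻¹ ≤ ENNReal.ofReal ε⁻¹ := by
    rw [ENNReal.ofReal_inv_of_pos hε]
    exact ENNReal.inv_le_inv.mpr h1
  refine Measure.le_iff.mpr fun s _ => ?_
  simp only [ProbabilityTheory.cond, Measure.smul_apply, smul_eq_mul]
  exact mul_le_mul' h2 (Measure.restrict_apply_le _ _)

/-- The restricted measures cost one factor `b` and the normalizing masses another. -/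
lemma cond_le_smul_cond {μ η : Measure E} [IsProbabilityMeasure μ] [IsProbabilityMeasure η]
    {C : Set E} {b : ℝ≥0∞} (hb : b ≠ 0) (hb' : b ≠ ∞)
    (h : μ.restrict C ≤ b • η.restrict C) (h' : η.restrict C ≤ b • μ.restrict C) :
    ProbabilityTheory.cond μ C ≤ b ^ 2 • ProbabilityTheory.cond η C := by
  have h1 : η C ≤ b * μ C := by simpa using h' Set.univ
  have h2 : (μ C)⁻¹ ≤ b * (η C)⁻¹ := by
    rw [← ENNReal.inv_le_inv, inv_inv, ENNReal.mul_inv (Or.inl hb) (Or.inl hb'), inv_inv,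
      ENNReal.inv_mul_le_iff hb hb']
    exact h1
  refine Measure.le_iff.mpr fun s _ => ?_
  simp only [ProbabilityTheory.cond, Measure.smul_apply, smul_eq_mul]
  calc (μ C)⁻¹ * μ.restrict C s ≤ (b * (η C)⁻¹) * (b * η.restrict C s) := mul_le_mul' h2 (h s)
    _ = _ := by ring

lemma withDensity_restrict_le {vol : Measure E} {C : Set E} (hC : MeasurableSet C) {k k' : E → ℝ}
    (hk' : Measurable k') {b : ℝ} (hb : 0 ≤ b)
    (h : ∀ z ∈ C, k z ≤ b * k' z) :
    (vol.withDensity fun z => ENNReal.ofReal (k z)).restrict C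
      ≤ ENNReal.ofReal b • (vol.withDensity fun z => ENNReal.ofReal (k' z)).restrict C := by
  rw [restrict_withDensity hC, restrict_withDensity hC,
    ← withDensity_smul _ hk'.ennreal_ofReal]
  refine withDensity_mono ?_
  filter_upwards [ae_restrict_mem hC] with z hz
  rw [Pi.smul_apply, smul_eq_mul, ← ENNReal.ofReal_mul hb]
  exact ENNReal.ofReal_le_ofReal (h z hz)

/-- Positive densities give all the measures `K_n(x, ·)` the same null sets as `vol`. -/
lemma Regular.kernel_apply_ne_zero {S : SSM E} {M : ℕ∞} {vol : Measure E}
    {k : ℕ → E → E → ℝ} (hR : S.Regular M vol k) {n : ℕ} (hn : n ∈ obsTimes M)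
    {B : Set E} {x y : E} (h : S.kernel n x B ≠ 0) : S.kernel n y B ≠ 0 := by
  have key : ∀ z, S.kernel n z B = 0 ↔ vol B = 0 := by
    intro z
    rw [hR.density n hn z, withDensity_apply_eq_zero (hR.measurable n hn z).ennreal_ofReal]
    have : {w | ENNReal.ofReal (k n z w) ≠ 0} = Set.univ :=
      Set.eq_univ_of_forall fun w => by simpa using hR.pos n hn z w
    rw [this, Set.univ_inter]
  rw [Ne, key] at h ⊢
  exact h

lemma constraint_nonempty [TopologicalSpace E] {S : SSM E} {M : ℕ∞}
    {C : ℕ → TopologicalSpace.Compacts E} {ε : ℝ} (hS : S.IsMarkov M) (hε : 0 < ε)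
    (hinit : ε ≤ S.init.real (C 0 : Set E))
    (hker : ∀ n ∈ obsTimes M, ∀ x ∈ C (n - 1), ε ≤ (S.kernel n x).real (C n : Set E)) :
    ∀ {n : ℕ}, (n : ℕ∞) ≤ M → (C n : Set E).Nonempty
  | 0, _ => by
      rw [Set.nonempty_iff_ne_empty]
      intro h
      rw [h] at hinit
      simp only [measureReal_empty] at hinit
      linarith
  | n + 1, h => by
      obtain ⟨x, hx⟩ := constraint_nonempty hS hε hinit hker (n := n)
        (le_trans (by exact_mod_cast Nat.le_succ n) h)
      rw [Set.nonempty_iff_ne_empty]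
      intro he
      have := hker (n + 1) ⟨by omega, h⟩ x (by simpa using hx)
      rw [he] at this
      simp only [measureReal_empty] at this
      linarith

end Conditioning

/-! ### The constrained model. -/

section Constrained

variable {E : Type*} [MeasurableSpace E] [TopologicalSpace E] [T2Space E]
  [OpensMeasurableSpace E] {S : SSM E} {M : ℕ∞} {vol : Measure E} {k : ℕ → E → E → ℝ}
  {C : ℕ → TopologicalSpace.Compacts E} {ε ζ G : ℝ}

lemma Confined.constrain (hS : S.Confined M (fun _ => Set.univ) ζ G) (hR : S.Regular M vol k)
    (hε : 0 < ε) (hinit : ε ≤ S.init.real (C 0 : Set E))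
    (hker : ∀ n ∈ obsTimes M, ∀ x ∈ C (n - 1), ε ≤ (S.kernel n x).real (C n : Set E)) :
    (S.constrain C).Confined M (fun n => (C n : Set E)) ζ G where
  init := by
    have := hS.init
    refine cond_isProbabilityMeasure fun h => ?_
    rw [measureReal_def, h] at hinit
    simp only [ENNReal.toReal_zero] at hinit
    linarith
  kernel n hn := by
    have := hS.kernel n hn
    refine ⟨fun y => cond_isProbabilityMeasure ?_⟩
    -- The mass bound speaks only of starting points in `C (n - 1)`. One such point gives `C n`
    -- positive mass, and equivalence of the kernels carries this to every `y`.
    obtain ⟨x, hx⟩ := constraint_nonempty hS.toIsMarkov hε hinit hker (n := n - 1)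
      (le_trans (by exact_mod_cast Nat.sub_le n 1) hn.2)
    refine hR.kernel_apply_ne_zero hn (x := x) fun h => ?_
    have := hker n hn x hx
    rw [measureReal_def, h] at this
    simp only [ENNReal.toReal_zero] at this
    linarith
  lik := hS.lik
  measurableSet n _ := (C n).isCompact.measurableSet
  init_mem := ae_cond_mem (C 0).isCompact.measurableSet
  kernel_mem n _ _ := ae_cond_mem (C n).isCompact.measurableSet
  zeta_pos := hS.zeta_pos
  zeta_le := hS.zeta_le
  le_lik := hS.le_lik
  lik_le := hS.lik_le

lemma constrain_init_le (hS : S.IsMarkov M) (hε : 0 < ε)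
    (hinit : ε ≤ S.init.real (C 0 : Set E)) :
    (S.constrain C).init ≤ ENNReal.ofReal ε⁻¹ • S.init := by
  have := hS.init
  exact cond_le_smul hε hinit

lemma constrain_kernel_le (hS : S.IsMarkov M) (hε : 0 < ε)
    (hker : ∀ n ∈ obsTimes M, ∀ x ∈ C (n - 1), ε ≤ (S.kernel n x).real (C n : Set E)) :
    ∀ n ∈ obsTimes M, ∀ x ∈ C (n - 1),
      (S.constrain C).kernel n x ≤ ENNReal.ofReal ε⁻¹ • S.kernel n x := by
  intro n hn x hx
  have := hS.kernel n hn
  exact cond_le_smul hε (hker n hn x hx)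

/-- On the constraint, `k n x z ≤ ‖k‖_∞ ≤ (‖k‖_∞ / γ) k n y z`; conditioning squares the factor. -/
lemma constrain_kernel_mixing (hS : S.IsMarkov M) (hR : S.Regular M vol k) {γ : ℝ} (hγ : 0 < γ)
    (hlow : ∀ n ∈ obsTimes M, ∀ x ∈ C (n - 1), ∀ z ∈ C n, γ ≤ k n x z) (hk : 0 < kSup M k) :
    ∀ n ∈ obsTimes M, ∀ x ∈ C (n - 1), ∀ y ∈ C (n - 1), (S.constrain C).kernel n x
      ≤ ENNReal.ofReal (γ ^ 2 / kSup M k ^ 2)⁻¹ • (S.constrain C).kernel n y := by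
  intro n hn x hx y hy
  have := hS.kernel n hn
  have hr : ∀ x ∈ C (n - 1), ∀ y ∈ C (n - 1), (S.kernel n x).restrict (C n)
      ≤ ENNReal.ofReal (kSup M k / γ) • (S.kernel n y).restrict (C n) := by
    intro x _ y hy
    rw [hR.density n hn x, hR.density n hn y]
    refine withDensity_restrict_le (C n).isCompact.measurableSet (hR.measurable n hn y)
      (by positivity) fun z hz => ?_
    calc k n x z ≤ kSup M k := le_csSup hR.bdd ⟨n, hn, x, z, rfl⟩
      _ = kSup M k / γ * γ := by field_simp
      _ ≤ _ := by
        have := hlow n hn y hy z hz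
        gcongr
  have h := cond_le_smul_cond (by simpa using by positivity) ENNReal.ofReal_ne_top
    (hr x hx y hy) (hr y hy x hx)
  rw [← ENNReal.ofReal_pow (by positivity), div_pow] at h
  rw [inv_div]
  exact h

end Constrained

variable {E : Type*} [MeasurableSpace E] {S : SSM E} {M : ℕ∞} {vol : Measure E}
  {k : ℕ → E → E → ℝ} {ζ : ℝ}

lemma one_mem_obsTimes (hM : 1 ≤ M) : 1 ∈ obsTimes M := ⟨le_rfl, by exact_mod_cast hM⟩

lemma Regular.confined_univ (hR : S.Regular M vol k) (hS : S.IsMarkov M) (hM : 1 ≤ M)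
    (hζ : 0 < ζ) (hlik : ∀ n ∈ obsTimes M, ∀ x, ζ < S.lik n x) :
    S.Confined M (fun _ => Set.univ) ζ (S.gSup M) := by
  have hle : ∀ n ∈ obsTimes M, ∀ x, S.lik n x ≤ S.gSup M := fun n hn x =>
    (le_abs_self _).trans (le_csSup hR.lik_bdd ⟨n, hn, x, rfl⟩)
  have hi := hS.init
  have : Nonempty E := nonempty_of_isProbabilityMeasure S.init
  have h1 := one_mem_obsTimes hM
  exact
    { toIsMarkov := hS
      measurableSet := fun _ _ => MeasurableSet.univ
      init_mem := ae_of_all _ fun x => Set.mem_univ x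
      kernel_mem := fun _ _ _ => ae_of_all _ fun x => Set.mem_univ x
      zeta_pos := hζ
      zeta_le := (hlik 1 h1 (Classical.arbitrary E)).le.trans (hle 1 h1 _)
      le_lik := fun n hn x => (hlik n hn x).le
      lik_le := hle }

end SSM

/-! ### The main theorem. -/

theorem theorem3 :
    ∃ cp : ℝ → ℝ,
      ∀ (M : ℕ∞) (d : ℕ) (X : Set (EuclideanSpace ℝ (Fin d))) (S : SSM X)
        (k : ℕ → X → X → ℝ) (r : ℕ → ℝ) (ζ : ℝ)
        (C : ℕ → ℕ → TopologicalSpace.Compacts X) (ε γbar : ℕ → ℝ),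
        1 ≤ M → MeasurableSet X → S.IsMarkov M →
        S.Regular M ((volume : Measure (EuclideanSpace ℝ (Fin d))).comap Subtype.val) k →
        S.Stable M r →
        0 < ζ → (∀ n ∈ obsTimes M, ∀ x, ζ < S.lik n x) →
        S.MassCondition M C ε →
        (∀ l, 0 < γbar l) →
        (∀ l, ∀ n ∈ obsTimes M, ∀ x' ∈ C l (n - 1), ∀ x ∈ C l n, γbar l ≤ k n x' x) →
      ∃ c : ℝ,
        (∀ l n : ℕ, (n : ℕ∞) ≤ M → ∀ f : X → ℝ, IsTest f →
          |∫ x, f x ∂(S.filter n) - ∫ x, f x ∂((S.constrain (C l)).filter n)|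
            ≤ c * ((1 - ε l) / ε l)) ∧
        ∀ p : ℝ, 1 ≤ p →
          (∀ l N : ℕ, 1 ≤ N →
            (⨆ n ∈ obsTimes M, ⨆ (f : X → ℝ) (_ : IsTest f),
                (S.constrain (C l)).pfError (S.filter n) N n p f)
              < ENNReal.ofReal (c * ((1 - ε l) / ε l) +
                  cp p * S.gSup M / (ζ * (γbar l ^ 2 / SSM.kSup M k ^ 2) ^ 3 * √(N : ℝ)))) ∧
          (∀ l : ℕ, ∃ L : ℝ≥0∞,
            Tendsto (fun N : ℕ => ⨆ n ∈ obsTimes M, ⨆ (f : X → ℝ) (_ : IsTest f),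
                (S.constrain (C l)).pfError (S.filter n) N n p f) atTop (𝓝 L) ∧
            L ≤ ENNReal.ofReal (c * ((1 - ε l) / ε l)) ∧
            (ε l < 1 → L < ENNReal.ofReal (c * ((1 - ε l) / ε l)))) ∧
          ∃ cbar : ℝ, ∀ N : ℕ, 1 ≤ N → ∃ L : ℕ → (X → ℝ) → ℝ≥0∞,
            (∀ n : ℕ, (n : ℕ∞) ≤ M → ∀ f : X → ℝ, IsTest f →
              Tendsto (fun l : ℕ => (S.constrain (C l)).pfError (S.filter n) N n p f)
                atTop (𝓝 (L n f))) ∧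
            (⨆ (n : ℕ) (_ : (n : ℕ∞) ≤ M) (f : X → ℝ) (_ : IsTest f), L n f)
              < ENNReal.ofReal (cbar / √(N : ℝ)) := by
  -- The `+ 1` here, and in `c₀ + 1` and `K + 1` below, turns weak bounds into strict ones.
  refine ⟨fun p => 4 * momentConst p + 1, ?_⟩
  intro M d X S k r ζ C ε γbar hM _ hMarkov hR hStable hζ hlik hmass hγbar hlow
  have hS := hR.confined_univ hMarkov hM hζ hlik
  have hG : 0 < S.gSup M := hζ.trans_le hS.zeta_le
  have h1M := SSM.one_mem_obsTimes hM
  have hinitS := hMarkov.init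
  have hT : ∀ l, (S.constrain (C l)).Confined M (fun n => (C l n : Set X)) ζ (S.gSup M) :=
    fun l => hS.constrain hR (hmass.pos l) (hmass.init l) (hmass.kernel l)
  have hε1 : ∀ l, ε l ≤ 1 := fun l => (hmass.init l).trans measureReal_le_one
  have hεinv : ∀ l, 1 ≤ (ε l)⁻¹ := fun l => (one_le_inv₀ (hmass.pos l)).mpr (hε1 l)
  have hεe : ∀ l, (1 - ε l) / ε l = (ε l)⁻¹ - 1 := fun l => by
    have := (hmass.pos l).ne'
    field_simp
  have hdom : ∀ l, ∀ n ∈ obsTimes M, ∀ x ∈ (C l (n - 1) : Set X), (S.constrain (C l)).kernel n x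
      ≤ ENNReal.ofReal (ε l)⁻¹ • S.kernel n x := fun l =>
    SSM.constrain_kernel_le hMarkov (hmass.pos l) (hmass.kernel l)
  have hdom0 : ∀ l, (S.constrain (C l)).init ≤ ENNReal.ofReal (ε l)⁻¹ • S.init := fun l =>
    SSM.constrain_init_le hMarkov (hmass.pos l) (hmass.init l)
  set R := ∑' i, r i
  have hR0 : 0 ≤ R := tsum_nonneg hStable.nonneg
  set c₀ := 4 * S.gSup M / ζ * R with hc₀
  have hc₀0 : 0 ≤ c₀ := by positivity
  have hbias : ∀ l n : ℕ, (n : ℕ∞) ≤ M → ∀ f : X → ℝ, IsTest f →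
      |∫ x, f x ∂(S.filter n) - ∫ x, f x ∂((S.constrain (C l)).filter n)|
        ≤ c₀ * ((1 - ε l) / ε l) := fun l n hn f hf => by
    rw [hεe]
    exact hStable.abs_filter_sub_le hS (hT l) rfl (hεinv l) (hdom0 l) (hdom l) hn hf
  have hx0 : ∀ l, 0 ≤ (1 - ε l) / ε l := fun l => by rw [hεe]; linarith [hεinv l]
  refine ⟨c₀ + 1, fun l n hn f hf => (hbias l n hn f hf).trans ?_, fun p hp => ?_⟩
  · have := hx0 l
    gcongr
    linarith
  have hb := momentConst_pos p
  -- Nonempty constraints at times `0` and `1` supply a point where the density lies between `γbar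
  -- l` and `‖k‖_∞`.
  have hγ : ∀ l, 0 < γbar l ^ 2 / SSM.kSup M k ^ 2 ∧ γbar l ^ 2 / SSM.kSup M k ^ 2 ≤ 1 ∧
      0 < SSM.kSup M k := by
    intro l
    obtain ⟨x, hx⟩ := SSM.constraint_nonempty hMarkov (hmass.pos l) (hmass.init l)
      (hmass.kernel l) (n := 0) (by simp)
    obtain ⟨y, hy⟩ := SSM.constraint_nonempty hMarkov (hmass.pos l) (hmass.init l)
      (hmass.kernel l) h1M.2
    have h2 : γbar l ≤ SSM.kSup M k := (hlow l 1 h1M x hx y hy).trans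
      (le_csSup hR.bdd ⟨1, h1M, x, y, rfl⟩)
    have h3 := hγbar l
    have h4 : 0 < SSM.kSup M k := h3.trans_le h2
    refine ⟨by positivity, ?_, h4⟩
    rw [div_le_one (by positivity)]
    gcongr
  have hpf : ∀ l N : ℕ, 1 ≤ N → ∀ n ∈ obsTimes M, ∀ f : X → ℝ, IsTest f →
      (S.constrain (C l)).pfError ((S.constrain (C l)).filter n) N n p f ≤
        ENNReal.ofReal (4 * momentConst p * S.gSup M /
          (ζ * (γbar l ^ 2 / SSM.kSup M k ^ 2) ^ 3 * √(N : ℝ))) := fun l N hN n hn f hf =>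
    (hT l).pfError_le_of_mixing (hγ l).1 (hγ l).2.1
      (SSM.constrain_kernel_mixing hMarkov hR (hγbar l) (hlow l) (hγ l).2.2) hN hn.2 hf hp
  refine ⟨fun l N hN => ?_, fun l => ?_, ?_⟩
  · have hγl := (hγ l).1
    have hN0 : 0 < √(N : ℝ) := Real.sqrt_pos.mpr (by exact_mod_cast hN)
    have hxl := hx0 l
    refine lt_of_le_of_lt (b := ENNReal.ofReal (c₀ * ((1 - ε l) / ε l) +
      4 * momentConst p * S.gSup M / (ζ * (γbar l ^ 2 / SSM.kSup M k ^ 2) ^ 3 * √(N : ℝ)))) ?_ ?_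
    · refine iSup₂_le fun n hn => iSup₂_le fun f hf => ?_
      have := (hT l).isProbabilityMeasure_particleLaw hN hn.2
      rw [ENNReal.ofReal_add (by positivity) (by positivity)]
      exact (SSM.pfError_le_add hf _ ((S.constrain (C l)).filter n) hp).trans
        (add_le_add (ENNReal.ofReal_le_ofReal (hbias l n hn.2 f hf)) (hpf l N hN n hn f hf))
    · rw [ENNReal.ofReal_lt_ofReal_iff (by positivity)]
      refine add_lt_add_of_le_of_lt ?_ ?_
      · gcongr
        linarith
      · gcongr
        linarith
  · set δ : ℕ → ℝ≥0∞ := fun N => ENNReal.ofReal (4 * momentConst p * S.gSup M /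
      (ζ * (γbar l ^ 2 / SSM.kSup M k ^ 2) ^ 3 * √(N : ℝ))) with hδ
    -- The limit is the largest bias. By the triangle inequality in both directions, the uniform
    -- error with `N` particles lies between `L - δ N` and `L + δ N`.
    set L : ℝ≥0∞ := ⨆ n ∈ obsTimes M, ⨆ (f : X → ℝ) (_ : IsTest f),
      ENNReal.ofReal |∫ x, f x ∂(S.filter n) - ∫ x, f x ∂((S.constrain (C l)).filter n)| with hL
    have hLle : L ≤ ENNReal.ofReal (c₀ * ((1 - ε l) / ε l)) :=
      iSup₂_le fun n hn => iSup₂_le fun f hf =>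
        ENNReal.ofReal_le_ofReal (hbias l n hn.2 f hf)
    have hδ0 : Tendsto δ atTop (𝓝 0) := by
      rw [← ENNReal.ofReal_zero]
      refine ENNReal.tendsto_ofReal (Tendsto.const_div_atTop ?_ _)
      have hγl := (hγ l).1
      exact (Real.tendsto_sqrt_atTop.comp tendsto_natCast_atTop_atTop).const_mul_atTop
        (by positivity)
    have hlow : Tendsto (fun N => L - δ N) atTop (𝓝 L) := by
      have := ENNReal.Tendsto.sub (tendsto_const_nhds (x := L)) hδ0
        (Or.inl (ne_top_of_le_ne_top ENNReal.ofReal_ne_top hLle))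
      simpa using this
    have hup : Tendsto (fun N => L + δ N) atTop (𝓝 L) := by
      simpa using (tendsto_const_nhds (x := L)).add hδ0
    refine ⟨L, tendsto_of_tendsto_of_tendsto_of_le_of_le' hlow hup ?_ ?_, hLle.trans ?_,
      fun hlt => hLle.trans_lt ?_⟩
    · filter_upwards [eventually_ge_atTop 1] with N hN
      rw [tsub_le_iff_right]
      refine iSup₂_le fun n hn => iSup₂_le fun f hf => ?_
      have := (hT l).isProbabilityMeasure_particleLaw hN hn.2
      refine (SSM.ofReal_abs_le_pfError_add (T := S.constrain (C l)) (N := N) (n := n) hf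
        (S.filter n) ((S.constrain (C l)).filter n) hp).trans
        (add_le_add ?_ (hpf l N hN n hn f hf))
      exact le_iSup₂_of_le n hn (le_iSup₂_of_le f hf le_rfl)
    · filter_upwards [eventually_ge_atTop 1] with N hN
      refine iSup₂_le fun n hn => iSup₂_le fun f hf => ?_
      have := (hT l).isProbabilityMeasure_particleLaw hN hn.2
      refine (SSM.pfError_le_add hf _ ((S.constrain (C l)).filter n) hp).trans
        (add_le_add ?_ (hpf l N hN n hn f hf))
      exact le_iSup₂_of_le n hn (le_iSup₂_of_le f hf le_rfl)
    · have := hx0 l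
      refine ENNReal.ofReal_le_ofReal ?_
      gcongr
      linarith
    · have : 0 < (1 - ε l) / ε l := div_pos (by linarith) (hmass.pos l)
      rw [ENNReal.ofReal_lt_ofReal_iff (by positivity)]
      gcongr
      linarith
  · set K := momentConst p * (S.gSup M / ζ + 1) * Real.exp (2 * S.gSup M / ζ * R) * (2 * R)
    have hK0 : 0 ≤ K := by positivity
    -- The limit in `l` is the error of the particle filter run on `S` itself.
    refine ⟨K + 1, fun N hN => ⟨fun n f => S.pfError (S.filter n) N n p f, ?_, ?_⟩⟩
    · intro n hn f hf
      have := hS.isProbabilityMeasure_particleLaw hN hn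
      -- One factor `1/ε l` for each particle and each of the times `0, …, n`.
      refine SSM.tendsto_pfError (c := fun l => ((ε l)⁻¹ ^ N) ^ (n + 1))
        (fun l => (hT l).isProbabilityMeasure_particleLaw hN hn)
        (fun l => one_le_pow₀ (one_le_pow₀ (hεinv l))) ?_ (fun l => ?_) hf _ hp
      · simpa using ((hmass.tendsto.inv₀ one_ne_zero).pow N).pow (n + 1)
      · have hpos := inv_pos.mpr (hmass.pos l)
        rw [ENNReal.ofReal_pow (by positivity), ENNReal.ofReal_pow hpos.le]
        exact (hT l).particleLaw_le hS rfl (by simpa using hmass.pos l) ENNReal.ofReal_ne_top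
          (hdom0 l) (hdom l) hN hn
    · have hN0 : 0 < √(N : ℝ) := Real.sqrt_pos.mpr (by exact_mod_cast hN)
      refine lt_of_le_of_lt (b := ENNReal.ofReal (K / √N)) (iSup₂_le fun n hn =>
        iSup₂_le fun f hf => hStable.pfError_le hS hN hn hf hp) ?_
      rw [ENNReal.ofReal_lt_ofReal_iff (by positivity)]
      gcongr
      linarith
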